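/- **Setting.** Let $K\ge 1$ and $D\ge 0$ be integers and $\Theta\subseteq\mathbb R^d$. For $\theta\in\Theta$ let $p_t(\theta)=p_{t+K}(\theta)\in[0,1]$, $t\in\mathbb N$, be $K$-periodic event probabilities, and write $p_t(\theta)=1-e^{-\lambda_t(\theta)}$ with rates $\lambda_t(\theta)\in[0,\infty]$. A *dead-time event detection (DED) process* is a $\{0,1\}^2$-valued process $X_t=(G_t,Y_t)$, $t\ge 0$, with a law $P_\theta$ for each $\theta\in\Theta$, such that under every $P_\theta$: 1. there are independent $Z_t\sim\mathrm{Ber}(p_t(\theta))$ with $Y_t=G_tZ_t$ a.s.; 2. $G_t=\Phi_t(G_0,Y_0,\dots,G_{t-1},Y_{t-1},U_t)$ a.s., where the $\Phi_t$ are measurable maps that do not depend on $\theta$ and $U_t$ is uniform on $[0,1]$ and independent of $\big((Z_s)_{s\ge 0},(G_s,Y_s)_{s<t}\big)$; 3. a.s., $Y_t=1$ implies $G_s=0$ for $t<s\le t+D$; 4. there is $\gamma(\theta)\in[0,1]^K$ with $\frac1L\sum_{\ell=0}^{L-1}G_{r+\ell K}\to\gamma_r(\theta)$ in $P_\theta$-probability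 as $L\to\infty$, for $r=0,\dots,K-1$. Let $P_{\theta,T}$ be the law of $(X_0,\dots,X_{T-1})$ under $P_\theta$. Put $$\mathcal I_0=\frac1K\sum_{r=0}^{K-1}\gamma_r(\theta_0)\,\frac{1-p_r(\theta_0)}{p_r(\theta_0)}\,\nabla\lambda_r(\theta_0)\nabla\lambda_r(\theta_0)^\top .$$ Assume that $\theta_0\in\operatorname{int}(\Theta)$ and that: there are constants $0<\lambda_{\min}\le\lambda_{\max}<\infty$ with $\lambda_{\min}\le\lambda_r(\theta)\le\lambda_{\max}$ for all $r=0,\dots,K-1$ and $\theta\in\Theta$; each $\lambda_r$ extends to a $C^3$ map on an open set containing $\Theta$; if $\theta\in\Theta$ and $\lambda_r(\theta)=\lambda_r(\theta_0)$ for all $r$ with $\gamma_r(\theta_0)>0$, then $\theta=\theta_0$; $\Theta$ is compact; $\mathcal I_0$ is positive definite. **Theorem.** Let $\hat\theta_T=\hat\theta_T(X_0,\dots,X_{T-1})\in\Theta$ be any maximum likelihood estimator, i.e. $\hat\theta_T\in\arg\max_{\theta\in\Theta}\log P_{\theta,T}(X_0,\dots,X_{T-1})$ for each $T$. Then, as $T\to\infty$: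 1. $\hat\theta_T$ is consistent: $\hat\theta_T\to\theta_0$ in $P_{\theta_0,T}$-probability. 2. $\hat\theta_T$ is asymptotically normal: $\sqrt T(\hat\theta_T-\theta_0)\Rightarrow\mathcal N(0,\mathcal I_0^{-1})$ under $P_{\theta_0,T}$. Since it has this limit law, it is asymptotically efficient (by definition, an estimator is asymptotically efficient at $\theta_0$ if its scaled error has the limit law $\mathcal N(0,\mathcal I_0^{-1})$). 3. $\hat\theta_T$ is regular: for every fixed $h\in\mathbb R^d$, $\sqrt T\big(\hat\theta_T-\theta_0-h/\sqrt T\big)\Rightarrow\mathcal N(0,\mathcal I_0^{-1})$ under $P_{\theta_0+h/\sqrt T,T}$. -/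

import Mathlib

open MeasureTheory ProbabilityTheory Filter Topology
open scoped ENNReal

namespace DED

/-- The parameter space `ℝ^d` with its Euclidean norm. -/
abbrev Param (d : ℕ) : Type := EuclideanSpace ℝ (Fin d)

/-- Finite data `x_{0:T-1}`, where `x_t = (g_t, y_t)` is the gate and the observed outcome. -/
abbrev Path (T : ℕ) : Type := Fin T → Bool × Bool

/-- The data `X_{0:T-1} = ((G_0, Y_0), …, (G_{T-1}, Y_{T-1}))` as a random variable. -/
def obs {Ω : Type*} (G Y : ℕ → Ω → Bool) (T : ℕ) (ω : Ω) : Path T :=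
  fun t => (G t ω, Y t ω)

/-- The defining properties of a dead-time event detection process under a single law `μ`:
`q t` is the event probability at time `t`, `K` the period, `D` the dead time,
`Φ t` the gating rule at time `t`, and `γ` the vector of limiting gating frequencies. -/
structure IsDEDLaw {Ω : Type*} [MeasurableSpace Ω] (μ : Measure Ω) (K D : ℕ) (q : ℕ → ℝ)
    (Φ : (t : ℕ) → Path t × unitInterval → Bool) (γ : Fin K → ℝ) (G Y : ℕ → Ω → Bool) :
    Prop where
  /-- The event probabilities are probabilities. -/
  prob_mem : ∀ t, q t ∈ Set.Icc (0 : ℝ) 1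
  /-- The event probabilities are `K`-periodic. -/
  periodic : ∀ t, q (t + K) = q t
  /-- Physical events `Z`, gating randomization `U`, observation relation `Y = G Z`
  and causal gating. -/
  causal : ∃ (Z : ℕ → Ω → Bool) (U : ℕ → Ω → unitInterval),
    (∀ t, Measurable (Z t)) ∧ (∀ t, Measurable (U t)) ∧
    -- the physical events are independent Bernoulli variables
    iIndepFun Z μ ∧
    (∀ t, μ {ω | Z t ω = true} = ENNReal.ofReal (q t)) ∧
    -- an observed outcome is the physical event, seen only when the gate is open
    (∀ t, ∀ᵐ ω ∂μ, Y t ω = (G t ω && Z t ω)) ∧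
    -- `U t` is uniform, and independent of the events together with the past observations
    (∀ t, μ.map (U t) = volume) ∧
    (∀ t, IndepFun (U t) (fun ω => ((fun s => Z s ω), obs G Y t ω)) μ) ∧
    -- the gate is chosen from the past observations and `U t`
    (∀ t, ∀ᵐ ω ∂μ, G t ω = Φ t (obs G Y t ω, U t ω))
  /-- A detection at time `t` closes the gate at the times `t + 1, …, t + D`. -/
  dead_time : ∀ t s, t < s → s ≤ t + D → ∀ᵐ ω ∂μ, Y t ω = true → G s ω = false
  /-- The gating frequencies lie in `[0, 1]`. -/
  freq_mem : ∀ r, γ r ∈ Set.Icc (0 : ℝ) 1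
  /-- In each phase, the empirical gating frequency converges in probability. -/
  gating_frequency : ∀ r : Fin K,
    TendstoInMeasure μ
      (fun (L : ℕ) ω => (1 / (L : ℝ)) *
        ∑ l ∈ Finset.range L, if G ((r : ℕ) + l * K) ω = true then (1 : ℝ) else 0)
      atTop (fun _ => γ r)

/-- A dead-time event detection process `(G_t, Y_t)` as a statistical model with parameter set
`Θ`: under every `P θ` with `θ ∈ Θ` it has event probabilities `p t θ` and gating frequencies
`γ θ`, while the gating rules `Φ t` do not depend on the parameter. -/
structure IsDEDProcess {d : ℕ} {Ω : Type*} [MeasurableSpace Ω] (Θ : Set (Param d)) (K D : ℕ)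
    (p : ℕ → Param d → ℝ) (Φ : (t : ℕ) → Path t × unitInterval → Bool)
    (γ : Param d → Fin K → ℝ) (P : Param d → Measure Ω) (G Y : ℕ → Ω → Bool) : Prop where
  period_pos : 0 < K
  measurable_rule : ∀ t, Measurable (Φ t)
  measurable_gate : ∀ t, Measurable (G t)
  measurable_outcome : ∀ t, Measurable (Y t)
  law : ∀ θ ∈ Θ, IsDEDLaw (P θ) K D (fun t => p t θ) Φ (γ θ) G Y

/-- The rate `λ_t(θ)`, determined by `p_t(θ) = 1 - exp (-λ_t(θ))` if `p_t(θ) < 1`. For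
`p_t(θ) = 1` the true rate is infinite; the value here is then `0`, which a positive
lower bound on the rate rules out. -/
noncomputable def rate {d : ℕ} (p : ℕ → Param d → ℝ) (t : ℕ) (θ : Param d) : ℝ :=
  -Real.log (1 - p t θ)

/-- The Fisher information matrix `((1 - p_r) / p_r) ∇λ_r ∇λ_rᵀ` of phase `r` (it is used at
interior points of the parameter set, where the gradient is the classical one). -/
noncomputable def phaseInfo {d : ℕ} (p : ℕ → Param d → ℝ) (r : ℕ) (θ : Param d) :
    Matrix (Fin d) (Fin d) ℝ :=
  ((1 - p r θ) / p r θ) •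
    Matrix.vecMulVec (fun i => gradient (rate p r) θ i) (fun i => gradient (rate p r) θ i)

/-- The information rate `(1 / K) ∑_r α_r I_r(θ)`. -/
noncomputable def infoRate {d K : ℕ} (p : ℕ → Param d → ℝ) (θ : Param d) (α : Fin K → ℝ) :
    Matrix (Fin d) (Fin d) ℝ :=
  (1 / (K : ℝ)) • ∑ r : Fin K, α r • phaseInfo p r θ

/-- The regularity assumptions at the true parameter `θ₀`. -/
structure RegularityAt {d K : ℕ} (Θ : Set (Param d)) (p : ℕ → Param d → ℝ)
    (γ : Param d → Fin K → ℝ) (θ₀ : Param d) : Prop where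
  mem_interior : θ₀ ∈ interior Θ
  /-- The rates are bounded away from zero and infinity. -/
  rate_bounds : ∃ lmin lmax : ℝ, 0 < lmin ∧ lmin ≤ lmax ∧
    ∀ r : Fin K, ∀ θ ∈ Θ, lmin ≤ rate p r θ ∧ rate p r θ ≤ lmax
  /-- Each rate extends to a `C^3` function on an open set containing `Θ`. -/
  smooth : ∀ r : Fin K, ∃ (V : Set (Param d)) (f : Param d → ℝ),
    IsOpen V ∧ Θ ⊆ V ∧ ContDiffOn ℝ 3 f V ∧ Set.EqOn f (rate p r) Θ
  /-- The rates on the asymptotically visited phases identify the true parameter. -/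
  identifiable : ∀ θ ∈ Θ,
    (∀ r : Fin K, 0 < γ θ₀ r → rate p r θ = rate p r θ₀) → θ = θ₀
  compact : IsCompact Θ
  info_posDef : (infoRate p θ₀ (γ θ₀)).PosDef

/-- A sequence of estimators: for each horizon, a function of the data. -/
abbrev Estimator (d : ℕ) : Type := (T : ℕ) → Path T → Param d

/-- The log-likelihood `log P_{θ,T}(x)` of the data `x`, with value `-∞` if `P_{θ,T}(x) = 0`. -/
noncomputable def logLik {d : ℕ} {Ω : Type*} [MeasurableSpace Ω] (P : Param d → Measure Ω)
    (G Y : ℕ → Ω → Bool) (T : ℕ) (x : Path T) (θ : Param d) : EReal :=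
  ENNReal.log (((P θ).map (obs G Y T)) {x})

/-- A maximum likelihood estimator over `Θ`. -/
def IsMLE {d : ℕ} {Ω : Type*} [MeasurableSpace Ω] (Θ : Set (Param d)) (P : Param d → Measure Ω)
    (G Y : ℕ → Ω → Bool) (est : Estimator d) : Prop :=
  ∀ (T : ℕ) (x : Path T), est T x ∈ Θ ∧ IsMaxOn (logLik P G Y T x) Θ (est T x)

/-- Consistency at `θ₀`: convergence to `θ₀` in probability under `θ₀`. -/
def IsConsistentAt {d : ℕ} {Ω : Type*} [MeasurableSpace Ω] (P : Param d → Measure Ω)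
    (G Y : ℕ → Ω → Bool) (est : Estimator d) (θ₀ : Param d) : Prop :=
  TendstoInMeasure (P θ₀) (fun T ω => est T (obs G Y T ω)) atTop (fun _ => θ₀)

/-- The scaled error `√T (θ̂_T - θ₀)` converges in distribution to `ν` under `θ₀`. -/
def HasErrorLimit {d : ℕ} {Ω : Type*} [MeasurableSpace Ω] (P : Param d → Measure Ω)
    [∀ θ, IsProbabilityMeasure (P θ)] (G Y : ℕ → Ω → Bool) (est : Estimator d) (θ₀ : Param d)
    (ν : Measure (Param d)) [IsProbabilityMeasure ν] : Prop :=
  TendstoInDistribution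
    (fun (T : ℕ) ω => Real.sqrt T • (est T (obs G Y T ω) - θ₀)) atTop id (fun _ => P θ₀) ν

/-- Regularity at `θ₀` with limit law `ν`: for every fixed `h`, the scaled error
`√T (θ̂_T - θ₀ - h / √T)` converges in distribution to `ν` under `θ₀ + h / √T`. -/
def IsRegularAt {d : ℕ} {Ω : Type*} [MeasurableSpace Ω] (P : Param d → Measure Ω)
    [∀ θ, IsProbabilityMeasure (P θ)] (G Y : ℕ → Ω → Bool) (est : Estimator d) (θ₀ : Param d)
    (ν : Measure (Param d)) [IsProbabilityMeasure ν] : Prop :=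
  ∀ h : Param d, TendstoInDistribution
    (fun (T : ℕ) ω =>
      Real.sqrt T • (est T (obs G Y T ω) - θ₀ - (Real.sqrt T)⁻¹ • h))
    atTop id (fun T => P (θ₀ + (Real.sqrt T)⁻¹ • h)) ν

/-- Asymptotic efficiency at `θ₀`: the scaled error converges in distribution under `θ₀` to the
law of minimal spread, the centred normal law whose covariance is the inverse information
matrix. -/
def IsEfficientAt {d K : ℕ} {Ω : Type*} [MeasurableSpace Ω] (p : ℕ → Param d → ℝ)
    (γ : Param d → Fin K → ℝ) (P : Param d → Measure Ω)
    [∀ θ, IsProbabilityMeasure (P θ)] (G Y : ℕ → Ω → Bool) (est : Estimator d) (θ₀ : Param d) :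
    Prop :=
  HasErrorLimit P G Y est θ₀ (multivariateGaussian 0 (infoRate p θ₀ (γ θ₀))⁻¹)

end DED

/-! The gate is chosen by a rule free of the parameter, so the mass of a path factors into a gating
part that does not involve `θ` and a product of Bernoulli factors over the open gates
(`measureReal_obs_inter`). By periodicity the likelihood then depends on `θ` only through the
numbers of detections and of open gates in each phase, and the estimator maximizes `countLogLik p v`
at the observed frequencies `v` (`isMaxOn_freq`). This splits the proof into deterministic analysis
in `v` and probability for `v`.

Deterministic part: at the limiting frequencies the criterion is a weighted sum of Bernoulli
cross-entropies, uniquely maximized at `θ₀` by Gibbs' inequality and identifiability. Compactness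
forces maximizers for nearby `v` to lie near `θ₀` (`eventually_maximizer_near`). The score vanishes
at such a maximizer, and its strict derivative in the parameter is minus the information. Hence the
maximizer minus `θ'` equals the inverse information applied to the score at `θ'`, up to a small
relative error, uniformly over `θ'` near `θ₀` (`eventually_maximizer_expansion`).

Probabilistic part: detections minus their compensators form a martingale with variance of order
`T`, and gate frequencies converge by assumption, so `v` converges under `θ₀`. A Cauchy–Schwarz
bound on the likelihood ratio carries this over to `θ₀ + u/√T`, whose own gating frequencies need
not be known (`tendsto_pathProb_freq_local`). For the score, dividing the exponential of `i` times
the normalized score by its one-step conditional characteristic functions gives expectation exactly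
one. This divisor depends only on the gate frequencies and tends to a constant, so the
characteristic function of the score converges to the Gaussian one (`tendsto_sum_exp_score`).

Since expansion and central limit theorem are both centred at the moving parameter, regularity
follows directly, without Le Cam's third lemma. The choice `u = 0` gives the limit law at `θ₀`. -/

namespace DED

/-! ### Path masses and martingale identities -/

/-- The probability of the outcome `y` given the gate `g`, when the event probability is `q`. -/
def outcomeMass (q : ℝ) (a : Bool × Bool) : ℝ :=
  if a.1 then (if a.2 then q else 1 - q) else (if a.2 then 0 else 1)

/-- The product of the gating probabilities along a path, for a gating kernel `κ`. -/
def gateMass (κ : (t : ℕ) → Path t → Bool → ℝ) : (T : ℕ) → Path T → ℝ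
  | 0, _ => 1
  | T + 1, x => gateMass κ T (fun i => x i.castSucc) *
      κ T (fun i => x i.castSucc) (x (Fin.last T)).1

/-- The probability of a path under the gating kernel `κ` and event probabilities `q`. -/
def pathMass (κ : (t : ℕ) → Path t → Bool → ℝ) (q : ℕ → ℝ) (T : ℕ) (x : Path T) : ℝ :=
  gateMass κ T x * ∏ t : Fin T, outcomeMass (q t) (x t)

/-- A gating kernel: probabilities of the gate states given the past. -/
structure IsGateKernel (κ : (t : ℕ) → Path t → Bool → ℝ) : Prop where
  nonneg : ∀ t x g, 0 ≤ κ t x g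
  add_eq_one : ∀ t x, κ t x true + κ t x false = 1

lemma outcomeMass_nonneg {q : ℝ} (hq : q ∈ Set.Icc (0 : ℝ) 1) (a : Bool × Bool) :
    0 ≤ outcomeMass q a := by
  obtain ⟨h0, h1⟩ := hq
  unfold outcomeMass
  split_ifs <;> linarith

lemma gateMass_nonneg {κ : (t : ℕ) → Path t → Bool → ℝ} (hκ : IsGateKernel κ) :
    ∀ (T : ℕ) (x : Path T), 0 ≤ gateMass κ T x
  | 0, _ => zero_le_one
  | T + 1, _ => mul_nonneg (gateMass_nonneg hκ T _) (hκ.nonneg _ _ _)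

lemma pathMass_nonneg {κ : (t : ℕ) → Path t → Bool → ℝ} (hκ : IsGateKernel κ) {q : ℕ → ℝ}
    (hq : ∀ t, q t ∈ Set.Icc (0 : ℝ) 1) (T : ℕ) (x : Path T) : 0 ≤ pathMass κ q T x :=
  mul_nonneg (gateMass_nonneg hκ T x) (Finset.prod_nonneg fun _ _ => outcomeMass_nonneg (hq _) _)

lemma sum_path_succ {M : Type*} [AddCommMonoid M] {T : ℕ} (H : Path (T + 1) → M) :
    ∑ x, H x = ∑ x : Path T, ∑ a : Bool × Bool, H (Fin.snoc (α := fun _ => Bool × Bool) x a) := by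
  rw [Finset.sum_comm, ← Fintype.sum_prod_type',
    ← (Fin.snocEquiv (fun _ : Fin (T + 1) => Bool × Bool)).sum_comp]
  rfl

lemma gateMass_snoc (κ : (t : ℕ) → Path t → Bool → ℝ) {T : ℕ} (x : Path T) (a : Bool × Bool) :
    gateMass κ (T + 1) (Fin.snoc (α := fun _ => Bool × Bool) x a) =
      gateMass κ T x * κ T x a.1 := by
  simp [gateMass]

lemma prod_snoc {M : Type*} [CommMonoid M] {T : ℕ} (F : ℕ → Bool × Bool → M) (x : Path T)
    (a : Bool × Bool) :
    ∏ t : Fin (T + 1), F t (Fin.snoc (α := fun _ => Bool × Bool) x a t) =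
      (∏ t : Fin T, F t (x t)) * F T a := by
  simp [Fin.prod_univ_castSucc]

lemma sum_snoc {M : Type*} [AddCommMonoid M] {T : ℕ} (F : ℕ → Bool × Bool → M) (x : Path T)
    (a : Bool × Bool) :
    ∑ t : Fin (T + 1), F t (Fin.snoc (α := fun _ => Bool × Bool) x a t) =
      (∑ t : Fin T, F t (x t)) + F T a := by
  simp [Fin.sum_univ_castSucc]

lemma pathMass_snoc (κ : (t : ℕ) → Path t → Bool → ℝ) (q : ℕ → ℝ) {T : ℕ} (x : Path T)
    (a : Bool × Bool) :
    pathMass κ q (T + 1) (Fin.snoc (α := fun _ => Bool × Bool) x a) =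
      pathMass κ q T x * (κ T x a.1 * outcomeMass (q T) a) := by
  rw [pathMass, gateMass_snoc, prod_snoc (fun t => outcomeMass (q t)), pathMass]
  ring

/-- Multiplicative martingales have expectation one. -/
lemma sum_gateMass_mul_prod {κ : (t : ℕ) → Path t → Bool → ℝ} (hκ : IsGateKernel κ)
    {F : ℕ → Bool × Bool → ℂ} (hF : ∀ t g, F t (g, true) + F t (g, false) = 1) (T : ℕ) :
    ∑ x : Path T, (gateMass κ T x : ℂ) * ∏ t : Fin T, F t (x t) = 1 := by
  induction T with
  | zero => simp [gateMass]
  | succ T ih =>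
    rw [sum_path_succ, ← ih]
    refine Finset.sum_congr rfl fun x _ => ?_
    simp_rw [gateMass_snoc, prod_snoc F]
    rw [Fintype.sum_prod_type]
    simp only [Fintype.sum_bool]
    have h1 := hF T true
    have h2 := hF T false
    have h3 : ((κ T x true : ℝ) : ℂ) + (κ T x false : ℝ) = 1 := by
      exact_mod_cast congrArg ((↑) : ℝ → ℂ) (hκ.add_eq_one T x)
    push_cast
    linear_combination (gateMass κ T x * ∏ t : Fin T, F t (x t)) *
      (κ T x true * h1 + κ T x false * h2 + h3)

/-- Multiplicative supermartingales. -/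
lemma sum_gateMass_mul_prod_le {κ : (t : ℕ) → Path t → Bool → ℝ} (hκ : IsGateKernel κ)
    {F : ℕ → Bool × Bool → ℝ} (hF0 : ∀ t a, 0 ≤ F t a) {c : ℝ}
    (hF : ∀ t g, F t (g, true) + F t (g, false) ≤ c) (T : ℕ) :
    ∑ x : Path T, gateMass κ T x * ∏ t : Fin T, F t (x t) ≤ c ^ T := by
  have hc : 0 ≤ c := (add_nonneg (hF0 0 (true, true)) (hF0 0 (true, false))).trans (hF 0 true)
  induction T with
  | zero => simp [gateMass]
  | succ T ih =>
    rw [sum_path_succ, pow_succ]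
    refine le_trans ?_ (mul_le_mul_of_nonneg_right ih hc)
    rw [Finset.sum_mul]
    refine Finset.sum_le_sum fun x _ => ?_
    simp_rw [gateMass_snoc, prod_snoc F]
    rw [Fintype.sum_prod_type]
    simp only [Fintype.sum_bool]
    have h0 : 0 ≤ gateMass κ T x * ∏ t : Fin T, F t (x t) :=
      mul_nonneg (gateMass_nonneg hκ T x) (Finset.prod_nonneg fun _ _ => hF0 _ _)
    have h1 := mul_le_mul_of_nonneg_left (hF T true) (hκ.nonneg T x true)
    have h2 := mul_le_mul_of_nonneg_left (hF T false) (hκ.nonneg T x false)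
    have h3 : κ T x true * (F T (true, true) + F T (true, false)) +
        κ T x false * (F T (false, true) + F T (false, false)) ≤ c := by
      calc _ ≤ (κ T x true + κ T x false) * c := by linarith
        _ = c := by rw [hκ.add_eq_one, one_mul]
    refine le_trans (le_of_eq ?_) (mul_le_mul_of_nonneg_left h3 h0)
    ring

lemma sum_outcomeMass (q : ℝ) (g : Bool) :
    outcomeMass q (g, true) + outcomeMass q (g, false) = 1 := by
  cases g <;> simp [outcomeMass]

lemma sum_pathMass {κ : (t : ℕ) → Path t → Bool → ℝ} (hκ : IsGateKernel κ) (q : ℕ → ℝ) (T : ℕ) :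
    ∑ x : Path T, pathMass κ q T x = 1 := by
  have := sum_gateMass_mul_prod hκ (F := fun t a => (outcomeMass (q t) a : ℂ))
    (fun t g => by exact_mod_cast congrArg ((↑) : ℝ → ℂ) (sum_outcomeMass (q t) g)) T
  exact_mod_cast this

/-- Additive martingales: the second moment is at most the sum of the conditional variances. -/
lemma sum_pathMass_mul_sq_le {κ : (t : ℕ) → Path t → Bool → ℝ} (hκ : IsGateKernel κ) {q : ℕ → ℝ}
    (hq : ∀ t, q t ∈ Set.Icc (0 : ℝ) 1) {a : ℕ → Bool × Bool → ℝ} {c : ℝ}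
    (h0 : ∀ t g, outcomeMass (q t) (g, true) * a t (g, true) +
      outcomeMass (q t) (g, false) * a t (g, false) = 0)
    (h2 : ∀ t b, a t b ^ 2 ≤ c) (T : ℕ) :
    ∑ x : Path T, pathMass κ q T x * (∑ t : Fin T, a t (x t)) ^ 2 ≤ c * T := by
  induction T with
  | zero => simp
  | succ T ih =>
    have hstep : ∑ x : Path (T + 1), pathMass κ q (T + 1) x * (∑ t : Fin (T + 1), a t (x t)) ^ 2 ≤
        ∑ x : Path T, (pathMass κ q T x * (∑ t : Fin T, a t (x t)) ^ 2 + pathMass κ q T x * c) := by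
      rw [sum_path_succ]
      refine Finset.sum_le_sum fun x _ => ?_
      simp_rw [pathMass_snoc, sum_snoc a]
      rw [Fintype.sum_prod_type]
      simp only [Fintype.sum_bool]
      rw [← mul_add]
      set A := ∑ t : Fin T, a t (x t)
      have hb : ∀ g, outcomeMass (q T) (g, true) * (A + a T (g, true)) ^ 2 +
          outcomeMass (q T) (g, false) * (A + a T (g, false)) ^ 2 ≤ A ^ 2 + c := by
        intro g
        have e0 := h0 T g
        have e1 := sum_outcomeMass (q T) g
        have e2 := mul_le_mul_of_nonneg_left (h2 T (g, true)) (outcomeMass_nonneg (hq T) (g, true))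
        have e3 := mul_le_mul_of_nonneg_left (h2 T (g, false))
          (outcomeMass_nonneg (hq T) (g, false))
        calc _ = A ^ 2 * (outcomeMass (q T) (g, true) + outcomeMass (q T) (g, false)) +
              2 * A * (outcomeMass (q T) (g, true) * a T (g, true) +
                outcomeMass (q T) (g, false) * a T (g, false)) +
              (outcomeMass (q T) (g, true) * a T (g, true) ^ 2 +
              outcomeMass (q T) (g, false) * a T (g, false) ^ 2) := by ring
          _ ≤ A ^ 2 + (outcomeMass (q T) (g, true) + outcomeMass (q T) (g, false)) * c := by
              rw [e0, add_mul _ _ c, e1]; linarith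
          _ = _ := by rw [e1, one_mul]
      have h3 : κ T x true * (outcomeMass (q T) (true, true) * (A + a T (true, true)) ^ 2 +
          outcomeMass (q T) (true, false) * (A + a T (true, false)) ^ 2) +
          κ T x false * (outcomeMass (q T) (false, true) * (A + a T (false, true)) ^ 2 +
          outcomeMass (q T) (false, false) * (A + a T (false, false)) ^ 2) ≤ A ^ 2 + c := by
        have h1 := mul_le_mul_of_nonneg_left (hb true) (hκ.nonneg T x true)
        have h2 := mul_le_mul_of_nonneg_left (hb false) (hκ.nonneg T x false)
        calc _ ≤ (κ T x true + κ T x false) * (A ^ 2 + c) := by linarith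
          _ = _ := by rw [hκ.add_eq_one, one_mul]
      refine le_trans (le_of_eq ?_) (mul_le_mul_of_nonneg_left h3 (pathMass_nonneg hκ hq T x))
      ring
    refine hstep.trans ?_
    rw [Finset.sum_add_distrib, ← Finset.sum_mul, sum_pathMass hκ]
    push_cast
    linarith

/-! ### The law of the data -/

/-- The gating kernel of the gating rules `Φ` driven by uniform variables. -/
noncomputable def gateProb (Φ : (t : ℕ) → Path t × unitInterval → Bool) (t : ℕ) (x : Path t)
    (g : Bool) : ℝ :=
  (volume : Measure unitInterval).real {u | Φ t (x, u) = g}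

lemma isGateKernel_gateProb {Φ : (t : ℕ) → Path t × unitInterval → Bool}
    (hΦ : ∀ t, Measurable (Φ t)) : IsGateKernel (gateProb Φ) where
  nonneg _ _ _ := measureReal_nonneg
  add_eq_one t x := by
    have hm : Measurable fun u => Φ t (x, u) := (hΦ t).comp measurable_prodMk_left
    have h : {u | Φ t (x, u) = false} = {u | Φ t (x, u) = true}ᶜ := by ext; simp
    have hs : MeasurableSet {u | Φ t (x, u) = true} := hm (measurableSet_singleton true)
    rw [gateProb, gateProb, h, measureReal_compl hs]
    simp

lemma obs_succ_eq_iff {Ω : Type*} (G Y : ℕ → Ω → Bool) {T : ℕ} (x : Path T) (a : Bool × Bool)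
    (ω : Ω) :
    obs G Y (T + 1) ω = Fin.snoc (α := fun _ => Bool × Bool) x a ↔
      obs G Y T ω = x ∧ G T ω = a.1 ∧ Y T ω = a.2 := by
  rw [← Fin.snoc_init_self (α := fun _ => Bool × Bool) (obs G Y (T + 1) ω)]
  refine ((Fin.snoc_injective2 (α := fun _ => Bool × Bool)).eq_iff).trans ?_
  refine and_congr Iff.rfl ?_
  rw [← Prod.mk_inj]
  simp [obs]

lemma measurable_obs {Ω : Type*} [MeasurableSpace Ω] {G Y : ℕ → Ω → Bool}
    (hG : ∀ t, Measurable (G t)) (hY : ∀ t, Measurable (Y t)) (T : ℕ) :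
    Measurable (obs G Y T) :=
  measurable_pi_lambda _ fun t => (hG t).prodMk (hY t)

/-- The induction on `T` must carry the future events `Z s`, `s ≥ T`. Only `U t` is assumed
independent of the past observations, so independence of `Z T` from the past has to be produced
along the way, from independence of the `Z` at time zero. -/
lemma measureReal_obs_inter {Ω : Type*} [MeasurableSpace Ω] {μ : Measure Ω}
    [IsProbabilityMeasure μ] {q : ℕ → ℝ} (hq : ∀ t, q t ∈ Set.Icc (0 : ℝ) 1)
    {Φ : (t : ℕ) → Path t × unitInterval → Bool} (hΦ : ∀ t, Measurable (Φ t))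
    {G Y Z : ℕ → Ω → Bool} {U : ℕ → Ω → unitInterval}
    (hZm : ∀ t, Measurable (Z t)) (hUm : ∀ t, Measurable (U t)) (hZ : iIndepFun Z μ)
    (hZq : ∀ t, μ {ω | Z t ω = true} = ENNReal.ofReal (q t))
    (hYZ : ∀ t, ∀ᵐ ω ∂μ, Y t ω = (G t ω && Z t ω)) (hU : ∀ t, μ.map (U t) = volume)
    (hind : ∀ t, IndepFun (U t) (fun ω => ((fun s => Z s ω), obs G Y t ω)) μ)
    (hG : ∀ t, ∀ᵐ ω ∂μ, G t ω = Φ t (obs G Y t ω, U t ω)) (T : ℕ) :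
    ∀ (x : Path T) (S : Finset ℕ), (∀ s ∈ S, T ≤ s) → ∀ z : ℕ → Bool,
      μ.real {ω | obs G Y T ω = x ∧ ∀ s ∈ S, Z s ω = z s} =
        pathMass (gateProb Φ) q T x * ∏ s ∈ S, outcomeMass (q s) (true, z s) := by
  have hZreal : ∀ s b, μ.real {ω | Z s ω = b} = outcomeMass (q s) (true, b) := by
    intro s b
    have ht : μ.real {ω | Z s ω = true} = q s := by
      rw [measureReal_def, hZq, ENNReal.toReal_ofReal (hq s).1]
    cases b
    · have h : {ω | Z s ω = false} = {ω | Z s ω = true}ᶜ := by ext; simp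
      have hs : MeasurableSet {ω | Z s ω = true} := hZm s (measurableSet_singleton true)
      rw [h, measureReal_compl hs, ht]
      simp [outcomeMass]
    · rw [ht]; simp [outcomeMass]
  have hUind : ∀ t (x : Path t) (g : Bool) (S : Finset ℕ) (z : ℕ → Bool),
      μ.real {ω | Φ t (x, U t ω) = g ∧ obs G Y t ω = x ∧ ∀ s ∈ S, Z s ω = z s} =
        gateProb Φ t x g * μ.real {ω | obs G Y t ω = x ∧ ∀ s ∈ S, Z s ω = z s} := by
    intro t x g S z
    have hA : MeasurableSet {u | Φ t (x, u) = g} :=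
      ((hΦ t).comp measurable_prodMk_left) (measurableSet_singleton g)
    have hB : MeasurableSet {b : (ℕ → Bool) × Path t | b.2 = x ∧ ∀ s ∈ S, b.1 s = z s} := by
      refine (measurable_snd (measurableSet_singleton x)).inter ?_
      have : {b : (ℕ → Bool) × Path t | ∀ s ∈ S, b.1 s = z s} =
          ⋂ s ∈ S, {b : (ℕ → Bool) × Path t | b.1 s = z s} := by ext; simp
      change MeasurableSet {b : (ℕ → Bool) × Path t | ∀ s ∈ S, b.1 s = z s}
      rw [this]
      refine Finset.measurableSet_biInter _ fun s _ => ?_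
      have hs : Measurable fun b : (ℕ → Bool) × Path t => b.1 s :=
        (measurable_pi_apply s).comp measurable_fst
      exact hs (measurableSet_singleton (z s))
    have h := (hind t).measure_inter_preimage_eq_mul _ _ hA hB
    have hAU : μ (U t ⁻¹' {u | Φ t (x, u) = g}) = volume {u | Φ t (x, u) = g} := by
      rw [← Measure.map_apply (hUm t) hA, hU]
    rw [hAU] at h
    have h' := congrArg ENNReal.toReal h
    rw [ENNReal.toReal_mul] at h'
    exact h'
  induction T with
  | zero =>
    intro x S _ z
    have h := hZ.measure_inter_preimage_eq_mul S (sets := fun s => {z s})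
      (fun s _ => measurableSet_singleton _)
    have h1 : {ω | obs G Y 0 ω = x ∧ ∀ s ∈ S, Z s ω = z s} = ⋂ s ∈ S, Z s ⁻¹' {z s} := by
      ext ω
      simp [Subsingleton.elim (obs G Y 0 ω) x]
    rw [h1, measureReal_def, h, ENNReal.toReal_prod]
    simp only [pathMass, gateMass, Finset.univ_eq_empty, Finset.prod_empty, one_mul]
    exact Finset.prod_congr rfl fun s _ => hZreal s (z s)
  | succ T ih =>
    intro x S hS z
    obtain ⟨x, a, rfl⟩ : ∃ (x' : Path T) (a : Bool × Bool),
        x = Fin.snoc (α := fun _ => Bool × Bool) x' a :=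
      ⟨_, _, (Fin.snoc_init_self (α := fun _ => Bool × Bool) x).symm⟩
    obtain ⟨g, y⟩ := a
    have hTS : T ∉ S := fun h => by simpa using hS T h
    have hae : ({ω | obs G Y (T + 1) ω = Fin.snoc (α := fun _ => Bool × Bool) x (g, y) ∧
        ∀ s ∈ S, Z s ω = z s} : Set Ω) =ᵐ[μ]
        {ω | Φ T (x, U T ω) = g ∧ obs G Y T ω = x ∧ (g && Z T ω) = y ∧ ∀ s ∈ S, Z s ω = z s} := by
      filter_upwards [hYZ T, hG T] with ω h1 h2
      apply propext
      change (obs G Y (T + 1) ω = Fin.snoc (α := fun _ => Bool × Bool) x (g, y) ∧ _) ↔ (_ ∧ _)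
      rw [obs_succ_eq_iff]
      constructor
      · rintro ⟨⟨rfl, h4, h5⟩, h6⟩
        simp only at h4 h5
        exact ⟨by rw [← h2, h4], rfl, by rw [← h5, h1, h4], h6⟩
      · rintro ⟨h3, rfl, h4, h5⟩
        have h6 : G T ω = g := by rw [h2, h3]
        exact ⟨⟨rfl, h6, by rw [h1, h6, h4]⟩, h5⟩
    rw [measureReal_congr hae, pathMass_snoc]
    -- A closed gate hides `Z T`: the outcome `false` imposes nothing on it, and the outcome `true`
    -- is impossible.
    cases g
    · cases y
      · simp only [Bool.false_and, true_and]
        rw [hUind, ih x S (fun s hs => (Nat.le_succ T).trans (hS s hs)) z]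
        simp [outcomeMass]
        ring
      · simp [outcomeMass]
    -- An open gate reveals `Z T`, so its value joins the prescribed future events and the induction
    -- hypothesis applies with `insert T S`.
    · have h1 : {ω | Φ T (x, U T ω) = true ∧ obs G Y T ω = x ∧ (true && Z T ω) = y ∧
          ∀ s ∈ S, Z s ω = z s} = {ω | Φ T (x, U T ω) = true ∧ obs G Y T ω = x ∧
          ∀ s ∈ insert T S, Z s ω = Function.update z T y s} := by
        ext ω
        simp only [Bool.true_and, Set.mem_ofPred_eq, Finset.forall_mem_insert,
          Function.update_self]
        refine and_congr Iff.rfl (and_congr Iff.rfl (and_congr Iff.rfl ?_))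
        refine forall₂_congr fun s hs => ?_
        rw [Function.update_of_ne (ne_of_mem_of_not_mem hs hTS)]
      rw [h1, hUind, ih x (insert T S) ?_ _, Finset.prod_insert hTS, Function.update_self]
      · have h2 : ∏ s ∈ S, outcomeMass (q s) (true, Function.update z T y s) =
            ∏ s ∈ S, outcomeMass (q s) (true, z s) := by
          refine Finset.prod_congr rfl fun s hs => ?_
          rw [Function.update_of_ne (ne_of_mem_of_not_mem hs hTS)]
        rw [h2]
        ring
      · intro s hs
        rcases Finset.mem_insert.1 hs with rfl | hs
        · exact le_rfl
        · exact (Nat.le_succ T).trans (hS s hs)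

/-- The law of the data of a dead-time event detection process. -/
lemma IsDEDLaw.measureReal_obs_eq {Ω : Type*} [MeasurableSpace Ω] {μ : Measure Ω}
    [IsProbabilityMeasure μ] {K D : ℕ} {q : ℕ → ℝ}
    {Φ : (t : ℕ) → Path t × unitInterval → Bool} {γ : Fin K → ℝ} {G Y : ℕ → Ω → Bool}
    (h : IsDEDLaw μ K D q Φ γ G Y) (hΦ : ∀ t, Measurable (Φ t)) {T : ℕ} (x : Path T) :
    μ.real (obs G Y T ⁻¹' {x}) = pathMass (gateProb Φ) q T x := by
  obtain ⟨Z, U, h1, h2, h3, h4, h5, h6, h7, h8⟩ := h.causal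
  have := measureReal_obs_inter h.prob_mem hΦ h1 h2 h3 h4 h5 h6 h7 h8 T x ∅ (by simp)
    (fun _ => true)
  simp only [Finset.notMem_empty, IsEmpty.forall_iff, implies_true, and_true,
    Finset.prod_empty, mul_one] at this
  exact this

lemma IsDEDLaw.integral_comp_obs {Ω : Type*} [MeasurableSpace Ω] {μ : Measure Ω}
    [IsProbabilityMeasure μ] {K D : ℕ} {q : ℕ → ℝ}
    {Φ : (t : ℕ) → Path t × unitInterval → Bool} {γ : Fin K → ℝ} {G Y : ℕ → Ω → Bool}
    (h : IsDEDLaw μ K D q Φ γ G Y) (hΦ : ∀ t, Measurable (Φ t)) (hG : ∀ t, Measurable (G t))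
    (hY : ∀ t, Measurable (Y t)) {E : Type*} [NormedAddCommGroup E] [NormedSpace ℝ E]
    [CompleteSpace E] {T : ℕ} (H : Path T → E) :
    ∫ ω, H (obs G Y T ω) ∂μ = ∑ x, pathMass (gateProb Φ) q T x • H x := by
  have hm := measurable_obs hG hY T
  have : IsProbabilityMeasure (μ.map (obs G Y T)) :=
    Measure.isProbabilityMeasure_map hm.aemeasurable
  rw [← integral_map hm.aemeasurable (f := H) (by
    exact (StronglyMeasurable.of_discrete (f := H)).aestronglyMeasurable)]
  rw [integral_fintype (Integrable.of_finite)]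
  refine Finset.sum_congr rfl fun x _ => ?_
  rw [map_measureReal_apply hm (measurableSet_singleton x), h.measureReal_obs_eq hΦ]

lemma IsDEDLaw.measureReal_preimage_obs {Ω : Type*} [MeasurableSpace Ω] {μ : Measure Ω}
    [IsProbabilityMeasure μ] {K D : ℕ} {q : ℕ → ℝ}
    {Φ : (t : ℕ) → Path t × unitInterval → Bool} {γ : Fin K → ℝ} {G Y : ℕ → Ω → Bool}
    (h : IsDEDLaw μ K D q Φ γ G Y) (hΦ : ∀ t, Measurable (Φ t)) (hG : ∀ t, Measurable (G t))
    (hY : ∀ t, Measurable (Y t)) {T : ℕ} (A : Set (Path T)) :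
    μ.real (obs G Y T ⁻¹' A) =
      ∑ x, pathMass (gateProb Φ) q T x * A.indicator (fun _ => (1 : ℝ)) x := by
  have hm := measurable_obs hG hY T
  have hA : MeasurableSet (obs G Y T ⁻¹' A) := hm (MeasurableSet.of_discrete)
  rw [← integral_indicator_one hA]
  exact h.integral_comp_obs hΦ hG hY (A.indicator (fun _ => (1 : ℝ)))

/-! ### Reduction of the likelihood to counts -/

/-- The number of open gates in phase `r`. -/
noncomputable def gateCount (K : ℕ) {T : ℕ} (x : Path T) (r : Fin K) : ℝ :=
  ∑ t : Fin T, if (t : ℕ) % K = r then (if (x t).1 then 1 else 0) else 0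

/-- The number of detections in phase `r`. -/
noncomputable def detCount (K : ℕ) {T : ℕ} (x : Path T) (r : Fin K) : ℝ :=
  ∑ t : Fin T, if (t : ℕ) % K = r then (if (x t).1 then (if (x t).2 then 1 else 0) else 0) else 0

/-- The log-likelihood for detection counts `v.1` and gate counts `v.2`, up to terms that do not
depend on the parameter. -/
noncomputable def countLogLik {d K : ℕ} (p : ℕ → Param d → ℝ)
    (v : (Fin K → ℝ) × (Fin K → ℝ)) (θ : Param d) : ℝ :=
  ∑ r : Fin K, (v.1 r * Real.log (p r θ) - (v.2 r - v.1 r) * rate p r θ)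

/-- Closed gates contribute nothing and the coefficients depend only on the phase, so the counts are
sufficient. Applied to the log-likelihood, to the score, and with `a = b` to the compensator of the
exponential. -/
lemma sum_phase {K : ℕ} (hK : 0 < K) {M : Type*} [AddCommGroup M] [Module ℝ M] {T : ℕ}
    (x : Path T) (a b : ℕ → M) :
    ∑ t : Fin T, (if (x t).1 then (if (x t).2 then a (t % K) else b (t % K)) else 0) =
      ∑ r : Fin K, (detCount K x r • a r + (gateCount K x r - detCount K x r) • b r) := by
  simp only [detCount, gateCount, ← Finset.sum_sub_distrib, Finset.sum_smul,
    ← Finset.sum_add_distrib]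
  rw [Finset.sum_comm]
  refine Finset.sum_congr rfl fun t _ => ?_
  rw [Finset.sum_eq_single (⟨t % K, Nat.mod_lt _ hK⟩ : Fin K)]
  · cases (x t).1 <;> cases (x t).2 <;> simp
  · intro r _ hr
    have : (t : ℕ) % K ≠ r := fun h => hr (Fin.ext h.symm)
    simp [this]
  · simp

section

variable {d K D : ℕ} {Ω : Type*} [MeasurableSpace Ω] {Θ : Set (Param d)} {p : ℕ → Param d → ℝ}
  {Φ : (t : ℕ) → Path t × unitInterval → Bool} {γ : Param d → Fin K → ℝ}
  {P : Param d → Measure Ω} {G Y : ℕ → Ω → Bool} {θ₀ θ : Param d}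

lemma IsDEDProcess.mem_Icc (h : IsDEDProcess Θ K D p Φ γ P G Y) (hθ : θ ∈ Θ) (t : ℕ) :
    p t θ ∈ Set.Icc (0 : ℝ) 1 :=
  (h.law θ hθ).prob_mem t

lemma IsDEDProcess.apply_mod (h : IsDEDProcess Θ K D p Φ γ P G Y) (hθ : θ ∈ Θ) (t : ℕ) :
    p (t % K) θ = p t θ :=
  (show Function.Periodic (fun t => p t θ) K from (h.law θ hθ).periodic).map_mod_nat t

lemma lt_one_of_rate_pos {r : ℕ} (hp : p r θ ∈ Set.Icc (0 : ℝ) 1) (hr : 0 < rate p r θ) :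
    p r θ < 1 := by
  refine lt_of_le_of_ne hp.2 fun h => ?_
  simp [rate, h] at hr

lemma eq_one_sub_exp {r : ℕ} (hp : p r θ ∈ Set.Icc (0 : ℝ) 1) (hr : 0 < rate p r θ) :
    p r θ = 1 - Real.exp (-rate p r θ) := by
  have := lt_one_of_rate_pos hp hr
  rw [rate, neg_neg, Real.exp_log (by linarith)]
  ring

lemma exists_prob_bounds (h : IsDEDProcess Θ K D p Φ γ P G Y) (hreg : RegularityAt Θ p γ θ₀) :
    ∃ c : ℝ, 0 < c ∧ ∀ θ ∈ Θ, ∀ t, c ≤ p t θ ∧ c ≤ 1 - p t θ := by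
  obtain ⟨lmin, lmax, h0, h1, h2⟩ := hreg.rate_bounds
  refine ⟨min (1 - Real.exp (-lmin)) (Real.exp (-lmax)), lt_min ?_ (Real.exp_pos _), ?_⟩
  · have : Real.exp (-lmin) < 1 := by simpa using h0
    linarith
  · intro θ hθ t
    rw [← h.apply_mod hθ t]
    obtain ⟨h3, h4⟩ := h2 ⟨t % K, Nat.mod_lt _ h.period_pos⟩ θ hθ
    simp only at h3 h4
    have h5 := eq_one_sub_exp (h.mem_Icc hθ (t % K)) (h0.trans_le h3)
    have h6 : Real.exp (-rate p (t % K) θ) ≤ Real.exp (-lmin) := Real.exp_le_exp.2 (by linarith)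
    have h7 : Real.exp (-lmax) ≤ Real.exp (-rate p (t % K) θ) := Real.exp_le_exp.2 (by linarith)
    exact ⟨(min_le_left _ _).trans (by linarith), (min_le_right _ _).trans (by linarith)⟩

/-- Nonvanishing excludes detections through a closed gate, where the mass is zero and `Real.log`
would take its default value. -/
lemma log_prod_outcomeMass (h : IsDEDProcess Θ K D p Φ γ P G Y) (hθ : θ ∈ Θ) {T : ℕ} (x : Path T)
    (hx : ∏ t : Fin T, outcomeMass (p t θ) (x t) ≠ 0) :
    Real.log (∏ t : Fin T, outcomeMass (p t θ) (x t)) =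
      countLogLik p (detCount K x, gateCount K x) θ := by
  rw [Real.log_prod (fun t ht => Finset.prod_ne_zero_iff.1 hx t ht)]
  have h1 := sum_phase h.period_pos x (fun r => Real.log (p r θ)) (fun r => -rate p r θ)
  have h2 : ∀ t : Fin T, Real.log (outcomeMass (p t θ) (x t)) = (if (x t).1 then
      (if (x t).2 then Real.log (p (t % K) θ) else -rate p (t % K) θ) else 0) := by
    intro t
    rw [rate, neg_neg, h.apply_mod hθ, outcomeMass]
    cases (x t).1 <;> cases (x t).2 <;> simp
  rw [Finset.sum_congr rfl fun t _ => h2 t, h1, countLogLik]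
  refine Finset.sum_congr rfl fun r _ => ?_
  simp only [smul_eq_mul]
  ring

/-- All nondegenerate event probabilities give the outcomes the same support. -/
lemma outcomeMass_pos_of_ne {q q' : ℝ} (hq0 : 0 < q) (hq1 : q < 1) {a : Bool × Bool}
    (h : outcomeMass q' a ≠ 0) : 0 < outcomeMass q a := by
  obtain ⟨g, y⟩ := a
  cases g <;> cases y <;> simp_all [outcomeMass]

/-- The gating factor is common to all parameters and cancels. It must be nonzero, since otherwise
every parameter maximizes the likelihood. The sequence `q` serves only to say that the path is
possible, so any law in the model may be used. -/
lemma isMaxOn_countLogLik [∀ θ, IsProbabilityMeasure (P θ)]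
    (h : IsDEDProcess Θ K D p Φ γ P G Y) (hreg : RegularityAt Θ p γ θ₀) {est : Estimator d}
    (hest : IsMLE Θ P G Y est) {T : ℕ} {x : Path T} {q : ℕ → ℝ}
    (hx : pathMass (gateProb Φ) q T x ≠ 0) :
    IsMaxOn (countLogLik p (detCount K x, gateCount K x)) Θ (est T x) := by
  obtain ⟨c, hc, hb⟩ := exists_prob_bounds h hreg
  obtain ⟨hmem, hmax⟩ := hest T x
  have hpos : ∀ θ ∈ Θ, 0 < ∏ t : Fin T, outcomeMass (p t θ) (x t) := by
    intro θ hθ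
    refine Finset.prod_pos fun t _ => outcomeMass_pos_of_ne ?_ ?_
      (Finset.prod_ne_zero_iff.1 (right_ne_zero_of_mul hx) t (Finset.mem_univ t))
    · linarith [(hb θ hθ t).1]
    · linarith [(hb θ hθ t).2]
  have hκ := isGateKernel_gateProb h.measurable_rule
  have hgate : 0 < gateMass (gateProb Φ) T x :=
    lt_of_le_of_ne (gateMass_nonneg hκ T x) (left_ne_zero_of_mul hx).symm
  have hlaw : ∀ θ ∈ Θ, ((P θ).map (obs G Y T)) {x} =
      ENNReal.ofReal (pathMass (gateProb Φ) (fun t => p t θ) T x) := by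
    intro θ hθ
    rw [Measure.map_apply (measurable_obs h.measurable_gate h.measurable_outcome T)
      (measurableSet_singleton x), ← (h.law θ hθ).measureReal_obs_eq h.measurable_rule x,
      ofReal_measureReal]
  intro θ hθ
  have h1 : logLik P G Y T x θ ≤ logLik P G Y T x (est T x) := hmax hθ
  rw [logLik, logLik, hlaw θ hθ, hlaw _ hmem, ENNReal.log_le_log_iff,
    ENNReal.ofReal_le_ofReal_iff (pathMass_nonneg hκ (h.mem_Icc hmem) T x)] at h1
  have h2 := le_of_mul_le_mul_left h1 hgate
  change countLogLik p _ θ ≤ countLogLik p _ (est T x)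
  rw [← log_prod_outcomeMass h hθ x (hpos θ hθ).ne',
    ← log_prod_outcomeMass h hmem x (hpos _ hmem).ne']
  exact Real.log_le_log (hpos θ hθ) h2

end

/-! ### Maximizers as a function of the frequencies -/

/-- Gibbs' inequality for Bernoulli laws. -/
lemma bernoulli_gibbs_lt {a b : ℝ} (ha0 : 0 < a) (ha1 : a < 1) (hb0 : 0 < b) (hb1 : b < 1)
    (hab : b ≠ a) :
    a * Real.log b + (1 - a) * Real.log (1 - b) < a * Real.log a + (1 - a) * Real.log (1 - a) := by
  have h1 : Real.log (b / a) < b / a - 1 :=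
    Real.log_lt_sub_one_of_pos (by positivity) (by rwa [Ne, div_eq_one_iff_eq ha0.ne'])
  have h2 : Real.log ((1 - b) / (1 - a)) ≤ (1 - b) / (1 - a) - 1 :=
    Real.log_le_sub_one_of_pos (div_pos (by linarith) (by linarith))
  rw [Real.log_div hb0.ne' ha0.ne'] at h1
  rw [Real.log_div (by linarith) (by linarith)] at h2
  have h3 := mul_lt_mul_of_pos_left h1 ha0
  have h4 := mul_le_mul_of_nonneg_left h2 (sub_pos.2 ha1).le
  have h5 : a * (b / a - 1) = b - a := by field_simp
  have h6 : (1 - a) * ((1 - b) / (1 - a) - 1) = a - b := by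
    have : (1 - a) ≠ 0 := by linarith
    field_simp
    ring
  linarith

/-- The limit of the detection and gate frequencies. -/
noncomputable def limitFreq {d K : ℕ} (p : ℕ → Param d → ℝ) (γ : Param d → Fin K → ℝ)
    (θ₀ : Param d) : (Fin K → ℝ) × (Fin K → ℝ) :=
  (fun r => γ θ₀ r / K * p r θ₀, fun r => γ θ₀ r / K)

/-- The gradient of `countLogLik p v`. -/
noncomputable def score {d K : ℕ} (p : ℕ → Param d → ℝ) (v : (Fin K → ℝ) × (Fin K → ℝ))
    (θ : Param d) : Param d :=
  ∑ r : Fin K, (v.1 r / p r θ - v.2 r) • gradient (rate p r) θ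

section

variable {d K D : ℕ} {Ω : Type*} [MeasurableSpace Ω] {Θ : Set (Param d)} {p : ℕ → Param d → ℝ}
  {Φ : (t : ℕ) → Path t × unitInterval → Bool} {γ : Param d → Fin K → ℝ}
  {P : Param d → Measure Ω} {G Y : ℕ → Ω → Bool} {θ₀ θ : Param d}

lemma rate_pos (hreg : RegularityAt Θ p γ θ₀) (hθ : θ ∈ Θ) (r : Fin K) : 0 < rate p r θ := by
  obtain ⟨lmin, lmax, h0, h1, h2⟩ := hreg.rate_bounds
  exact h0.trans_le (h2 r θ hθ).1

/-- At the limiting frequencies each phase contributes `γ_r / K` times a Bernoulli cross-entropy, so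
Gibbs' inequality applies phase by phase. Identifiability supplies a visited phase where it is
strict. -/
lemma countLogLik_lt (h : IsDEDProcess Θ K D p Φ γ P G Y) (hreg : RegularityAt Θ p γ θ₀)
    (hθ : θ ∈ Θ) (hne : θ ≠ θ₀) :
    countLogLik p (limitFreq p γ θ₀) θ < countLogLik p (limitFreq p γ θ₀) θ₀ := by
  have hθ₀ : θ₀ ∈ Θ := interior_subset hreg.mem_interior
  have hK : (0 : ℝ) < K := by exact_mod_cast h.period_pos
  obtain ⟨c, hc, hb⟩ := exists_prob_bounds h hreg
  have hterm : ∀ r : Fin K, ∀ θ', (limitFreq p γ θ₀).1 r * Real.log (p r θ') -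
      ((limitFreq p γ θ₀).2 r - (limitFreq p γ θ₀).1 r) * rate p r θ' =
      γ θ₀ r / K * (p r θ₀ * Real.log (p r θ') + (1 - p r θ₀) * Real.log (1 - p r θ')) := by
    intro r θ'
    simp only [limitFreq, rate]
    ring
  have hγ : ∀ r, 0 ≤ γ θ₀ r := fun r => ((h.law θ₀ hθ₀).freq_mem r).1
  have h01 : ∀ θ ∈ Θ, ∀ r : Fin K, 0 < p r θ ∧ p r θ < 1 := fun θ hθ r =>
    ⟨hc.trans_le (hb θ hθ r).1, by linarith [(hb θ hθ r).2]⟩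
  unfold countLogLik
  refine Finset.sum_lt_sum (fun r _ => ?_) ?_
  · rw [hterm, hterm]
    refine mul_le_mul_of_nonneg_left ?_ (div_nonneg (hγ r) hK.le)
    by_cases hr : p r θ = p r θ₀
    · rw [hr]
    · exact (bernoulli_gibbs_lt (h01 θ₀ hθ₀ r).1 (h01 θ₀ hθ₀ r).2 (h01 θ hθ r).1
        (h01 θ hθ r).2 hr).le
  · by_contra! hcon
    refine hne (hreg.identifiable θ hθ fun r hr => ?_)
    by_contra hrate
    have hp : p r θ ≠ p r θ₀ := fun h => hrate (by simp [rate, h])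
    have := hcon r (Finset.mem_univ r)
    rw [hterm, hterm] at this
    have h3 := bernoulli_gibbs_lt (h01 θ₀ hθ₀ r).1 (h01 θ₀ hθ₀ r).2 (h01 θ hθ r).1
      (h01 θ hθ r).2 hp
    exact absurd (le_of_mul_le_mul_left this (div_pos hr hK)) (not_le.2 h3)

lemma continuousOn_rate (hreg : RegularityAt Θ p γ θ₀) (r : Fin K) :
    ContinuousOn (rate p r) Θ := by
  obtain ⟨V, f, _, h2, h3, h4⟩ := hreg.smooth r
  exact (h3.continuousOn.mono h2).congr h4.symm

lemma continuousOn_prob (h : IsDEDProcess Θ K D p Φ γ P G Y) (hreg : RegularityAt Θ p γ θ₀)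
    (r : Fin K) : ContinuousOn (p r) Θ := by
  have : ContinuousOn (fun θ => 1 - Real.exp (-rate p r θ)) Θ :=
    continuousOn_const.sub (continuousOn_rate hreg r).neg.rexp
  exact this.congr fun θ hθ => eq_one_sub_exp (h.mem_Icc hθ r) (rate_pos hreg hθ r)

/-- Maximizers of the count likelihood at nearly limiting frequencies are near the truth. -/
lemma eventually_maximizer_near (h : IsDEDProcess Θ K D p Φ γ P G Y)
    (hreg : RegularityAt Θ p γ θ₀) {U : Set (Param d)} (hU : U ∈ 𝓝 θ₀) :
    ∀ᶠ v in 𝓝 (limitFreq p γ θ₀), ∀ θ ∈ Θ, IsMaxOn (countLogLik p v) Θ θ → θ ∈ U := by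
  have hθ₀ : θ₀ ∈ Θ := interior_subset hreg.mem_interior
  obtain ⟨c, hc, hb⟩ := exists_prob_bounds h hreg
  have hcont : Continuous fun z : ((Fin K → ℝ) × (Fin K → ℝ)) × Θ =>
      countLogLik p z.1 (z.2 : Param d) := by
    unfold countLogLik
    refine continuous_finsetSum _ fun r _ => ?_
    have h1 : Continuous fun z : ((Fin K → ℝ) × (Fin K → ℝ)) × Θ => rate p r z.2 :=
      (continuousOn_iff_continuous_domRestrict.1 (continuousOn_rate hreg r)).comp continuous_snd
    have h2 : Continuous fun z : ((Fin K → ℝ) × (Fin K → ℝ)) × Θ => p r z.2 :=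
      (continuousOn_iff_continuous_domRestrict.1 (continuousOn_prob h hreg r)).comp continuous_snd
    have h3 := h2.log fun z => (hc.trans_le (hb z.2 z.2.2 r).1).ne'
    fun_prop
  have := isCompact_iff_compactSpace.1 hreg.compact
  have hcomp : IsCompact {θ : Θ | (θ : Param d) ∉ interior U} :=
    ((isOpen_interior.preimage continuous_subtype_val).isClosed_compl).isCompact
  -- Strict inequality at the limiting frequencies persists near each pair of frequencies and
  -- parameter. Compactness of `Θ` outside `interior U` makes one neighbourhood of the frequencies
  -- serve all parameters.
  have key := hcomp.eventually_forall_of_forall_eventually (x₀ := limitFreq p γ θ₀)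
    (P := fun v θ => countLogLik p v (θ : Param d) < countLogLik p v θ₀) fun θ hθ => by
      have hne : (θ : Param d) ≠ θ₀ := fun he => hθ (he ▸ mem_interior_iff_mem_nhds.2 hU)
      have h0 : Continuous fun z : ((Fin K → ℝ) × (Fin K → ℝ)) × Θ =>
          countLogLik p z.1 θ₀ :=
        hcont.comp (f := fun z : ((Fin K → ℝ) × (Fin K → ℝ)) × Θ => (z.1, (⟨θ₀, hθ₀⟩ : Θ)))
            (by fun_prop)
      exact hcont.continuousAt.eventually_lt h0.continuousAt (countLogLik_lt h hreg θ.2 hne)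
  filter_upwards [key] with v hv θ hθ hmax
  by_contra hcon
  exact absurd (hmax hθ₀) (not_le.2 (hv ⟨θ, hθ⟩ fun hi => hcon (interior_subset hi)))

lemma contDiffAt_rate (hreg : RegularityAt Θ p γ θ₀) (hθ : θ ∈ interior Θ) (r : Fin K) :
    ContDiffAt ℝ 3 (rate p r) θ := by
  obtain ⟨V, f, h1, h2, h3, h4⟩ := hreg.smooth r
  have hΘ : Θ ∈ 𝓝 θ := mem_interior_iff_mem_nhds.1 hθ
  exact (h3.contDiffAt (mem_of_superset hΘ h2)).congr_of_eventuallyEq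
    (mem_of_superset hΘ fun x hx => (h4 hx).symm)

lemma contDiffAt_gradient_rate (hreg : RegularityAt Θ p γ θ₀) (hθ : θ ∈ interior Θ) (r : Fin K) :
    ContDiffAt ℝ 2 (gradient (rate p r)) θ := by
  have h1 : ContDiffAt ℝ 2 (fderiv ℝ (rate p r)) θ :=
    (contDiffAt_rate hreg hθ r).fderiv_right (by norm_num)
  exact (InnerProductSpace.toDual ℝ (Param d)).symm.contDiff.contDiffAt.comp θ h1

lemma prob_eventuallyEq (h : IsDEDProcess Θ K D p Φ γ P G Y) (hreg : RegularityAt Θ p γ θ₀)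
    (hθ : θ ∈ interior Θ) (r : Fin K) :
    p r =ᶠ[𝓝 θ] fun x => 1 - Real.exp (-rate p r x) :=
  mem_of_superset (mem_interior_iff_mem_nhds.1 hθ) fun _ hθ' =>
    eq_one_sub_exp (h.mem_Icc hθ' r) (rate_pos hreg hθ' r)

lemma hasStrictFDerivAt_rate (hreg : RegularityAt Θ p γ θ₀) (hθ : θ ∈ interior Θ) (r : Fin K) :
    HasStrictFDerivAt (rate p r)
      (InnerProductSpace.toDual ℝ (Param d) (gradient (rate p r) θ)) θ := by
  have := (contDiffAt_rate hreg hθ r).hasStrictFDerivAt (by norm_num)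
  simpa [gradient] using this

lemma hasStrictFDerivAt_prob (h : IsDEDProcess Θ K D p Φ γ P G Y) (hreg : RegularityAt Θ p γ θ₀)
    (hθ : θ ∈ interior Θ) (r : Fin K) :
    HasStrictFDerivAt (p r)
      ((1 - p r θ) • InnerProductSpace.toDual ℝ (Param d) (gradient (rate p r) θ)) θ := by
  have h1 := ((hasStrictFDerivAt_rate hreg hθ r).neg.exp).const_sub 1
  have h2 := prob_eventuallyEq h hreg hθ r
  refine (h1.congr_of_eventuallyEq h2.symm).congr_fderiv ?_
  rw [h2.self_of_nhds]
  simp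

/-- Since `∇p = (1 - p) ∇λ`, a phase contributes `v.1 (1 - p)/p - (v.2 - v.1) = v.1/p - v.2` times
`∇λ`. -/
lemma hasFDerivAt_countLogLik (h : IsDEDProcess Θ K D p Φ γ P G Y) (hreg : RegularityAt Θ p γ θ₀)
    (hθ : θ ∈ interior Θ) (v : (Fin K → ℝ) × (Fin K → ℝ)) :
    HasFDerivAt (countLogLik p v) (InnerProductSpace.toDual ℝ (Param d) (score p v θ)) θ := by
  obtain ⟨c, hc, hb⟩ := exists_prob_bounds h hreg
  unfold countLogLik score
  rw [map_sum]
  refine HasFDerivAt.fun_sum fun r _ => ?_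
  have hp : p r θ ≠ 0 := (hc.trans_le (hb θ (interior_subset hθ) r).1).ne'
  refine ((((hasStrictFDerivAt_prob h hreg hθ r).hasFDerivAt.log hp).const_mul (v.1 r)).sub
    ((hasStrictFDerivAt_rate hreg hθ r).hasFDerivAt.const_mul (v.2 r - v.1 r))).congr_fderiv ?_
  rw [map_smul, smul_smul, smul_smul, ← sub_smul]
  congr 1
  field_simp
  ring

lemma score_eq_zero_of_isMaxOn (h : IsDEDProcess Θ K D p Φ γ P G Y)
    (hreg : RegularityAt Θ p γ θ₀) (hθ : θ ∈ interior Θ) {v : (Fin K → ℝ) × (Fin K → ℝ)}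
    (hmax : IsMaxOn (countLogLik p v) Θ θ) : score p v θ = 0 := by
  have := (hmax.isLocalMax (mem_interior_iff_mem_nhds.1 hθ)).hasFDerivAt_eq_zero
    (hasFDerivAt_countLogLik h hreg hθ v)
  simpa using this

/-- The information matrix as an operator. -/
noncomputable def infoOp {d K : ℕ} (p : ℕ → Param d → ℝ) (θ : Param d) (α : Fin K → ℝ) :
    Param d →L[ℝ] Param d :=
  Matrix.toEuclideanCLM (𝕜 := ℝ) (infoRate p θ α)

/-- The inverse information matrix as an operator. -/
noncomputable def infoInv {d K : ℕ} (p : ℕ → Param d → ℝ) (θ : Param d) (α : Fin K → ℝ) :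
    Param d →L[ℝ] Param d :=
  Matrix.toEuclideanCLM (𝕜 := ℝ) (infoRate p θ α)⁻¹

lemma infoOp_apply (p : ℕ → Param d → ℝ) (θ : Param d) (α : Fin K → ℝ) (w : Param d) :
    infoOp p θ α w = ∑ r : Fin K, (α r / K * ((1 - p r θ) / p r θ) *
      inner ℝ (gradient (rate p r) θ) w) • gradient (rate p r) θ := by
  have h1 : ∀ u : Param d, Matrix.toEuclideanCLM (𝕜 := ℝ)
      (Matrix.vecMulVec (fun i => u i) (fun i => u i)) w = inner ℝ u w • u := by
    intro u
    apply (WithLp.linearEquiv 2 ℝ (Fin d → ℝ)).injective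
    change (Matrix.toEuclideanCLM (𝕜 := ℝ) _ w).ofLp = (inner ℝ u w • u).ofLp
    rw [Matrix.ofLp_toEuclideanCLM, Matrix.vecMulVec_mulVec, EuclideanSpace.inner_eq_star_dotProduct]
    ext i
    simp [dotProduct_comm, mul_comm]
  simp only [infoOp, infoRate, phaseInfo, map_smul, map_sum, smul_smul,
    _root_.smul_apply, _root_.sum_apply, h1]
  rw [Finset.smul_sum]
  refine Finset.sum_congr rfl fun r _ => ?_
  rw [smul_smul]
  congr 1
  ring

lemma infoInv_infoOp (hreg : RegularityAt Θ p γ θ₀) (w : Param d) :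
    infoInv p θ₀ (γ θ₀) (infoOp p θ₀ (γ θ₀) w) = w := by
  have h1 : (infoRate p θ₀ (γ θ₀))⁻¹ * infoRate p θ₀ (γ θ₀) = 1 :=
    Matrix.nonsing_inv_mul _ ((Matrix.isUnit_iff_isUnit_det _).1 hreg.info_posDef.isUnit)
  have h2 := congrArg (Matrix.toEuclideanCLM (𝕜 := ℝ)) h1
  rw [map_mul, map_one] at h2
  exact congrArg (fun L : Param d →L[ℝ] Param d => L w) h2

/-- Strict differentiability is needed because the score will be compared at two points, neither of
which is the base point. The comparison keeps `v` fixed, so only the derivative in the parameter has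
to be identified. -/
lemma exists_hasStrictFDerivAt_score (h : IsDEDProcess Θ K D p Φ γ P G Y)
    (hreg : RegularityAt Θ p γ θ₀) :
    ∃ L : ((Fin K → ℝ) × (Fin K → ℝ)) × Param d →L[ℝ] Param d,
      HasStrictFDerivAt (fun w : ((Fin K → ℝ) × (Fin K → ℝ)) × Param d => score p w.1 w.2) L
        (limitFreq p γ θ₀, θ₀) ∧ ∀ u, L (0, u) = -infoOp p θ₀ (γ θ₀) u := by
  have hθ₀ := hreg.mem_interior
  obtain ⟨c, hc, hb⟩ := exists_prob_bounds h hreg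
  have hp : ∀ r : Fin K, p r θ₀ ≠ 0 := fun r =>
    (hc.trans_le (hb θ₀ (interior_subset hθ₀) r).1).ne'
  let E := ((Fin K → ℝ) × (Fin K → ℝ)) × Param d
  let w₀ : E := (limitFreq p γ θ₀, θ₀)
  have hm : ∀ r : Fin K, HasStrictFDerivAt (fun w : E => w.1.1 r)
      ((ContinuousLinearMap.proj r).comp ((ContinuousLinearMap.fst ℝ _ _).comp
        (ContinuousLinearMap.fst ℝ _ _))) w₀ := fun r =>
    ((ContinuousLinearMap.proj (R := ℝ) (φ := fun _ : Fin K => ℝ) r).comp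
      ((ContinuousLinearMap.fst ℝ (Fin K → ℝ) (Fin K → ℝ)).comp
        (ContinuousLinearMap.fst ℝ _ (Param d)))).hasStrictFDerivAt
  have hn : ∀ r : Fin K, HasStrictFDerivAt (fun w : E => w.1.2 r)
      ((ContinuousLinearMap.proj r).comp ((ContinuousLinearMap.snd ℝ _ _).comp
        (ContinuousLinearMap.fst ℝ _ _))) w₀ := fun r =>
    ((ContinuousLinearMap.proj (R := ℝ) (φ := fun _ : Fin K => ℝ) r).comp
      ((ContinuousLinearMap.snd ℝ (Fin K → ℝ) (Fin K → ℝ)).comp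
        (ContinuousLinearMap.fst ℝ _ (Param d)))).hasStrictFDerivAt
  have hsnd : HasStrictFDerivAt (fun w : E => w.2) (ContinuousLinearMap.snd ℝ _ _) w₀ :=
    hasStrictFDerivAt_snd
  have hprob := fun r : Fin K => (hasStrictDerivAt_inv (hp r)).comp_hasStrictFDerivAt w₀
    (HasStrictFDerivAt.comp w₀ (hasStrictFDerivAt_prob h hreg hθ₀ r) hsnd)
  have hgrad := fun r : Fin K => HasStrictFDerivAt.comp w₀
    (((contDiffAt_gradient_rate hreg hθ₀ r).hasStrictFDerivAt (by norm_num))) hsnd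
  refine ⟨_, HasStrictFDerivAt.fun_sum fun r _ =>
    (((hm r).fun_mul (hprob r)).fun_sub (hn r)).fun_smul (hgrad r), ?_⟩
  intro u
  rw [infoOp_apply, ← Finset.sum_neg_distrib, _root_.sum_apply]
  refine Finset.sum_congr rfl fun r _ => ?_
  have := hp r
  simp [w₀, limitFreq]
  -- The coefficient `v.1/p - v.2` vanishes at the limiting frequencies and the truth, which removes
  -- the Hessian of the rate and leaves minus the information.
  rw [mul_assoc, mul_inv_cancel₀ this, mul_one, sub_self, zero_smul, zero_add, ← neg_smul]
  field_simp
  rw [neg_smul]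

/-- The maximizer is, to first order, the truth plus the normalized score. -/
lemma eventually_maximizer_expansion (h : IsDEDProcess Θ K D p Φ γ P G Y)
    (hreg : RegularityAt Θ p γ θ₀) {ε : ℝ} (hε : 0 < ε) :
    ∀ᶠ w in 𝓝 (limitFreq p γ θ₀) ×ˢ 𝓝 θ₀, ∀ θ ∈ Θ, IsMaxOn (countLogLik p w.1) Θ θ →
      ‖θ - w.2 - infoInv p θ₀ (γ θ₀) (score p w.1 w.2)‖ ≤
        ε * ‖infoInv p θ₀ (γ θ₀) (score p w.1 w.2)‖ := by
  obtain ⟨L, hL, hLu⟩ := exists_hasStrictFDerivAt_score h hreg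
  set J := infoInv p θ₀ (γ θ₀)
  -- With remainder `a` and main term `b`, the bound below reads `a ≤ δ (a + b)`. Then `δ ≤ 1/2`
  -- absorbs `a` on the left, and `2 δ ≤ ε` gives the claim.
  let δ := min (ε / 2) (1 / 2)
  have hδ : 0 < δ := lt_min (by linarith) (by norm_num)
  have hJ : 0 < ‖J‖ + 1 := by positivity
  have h1 := hL.isLittleO.def (div_pos hδ hJ)
  rw [nhds_prod_eq] at h1
  obtain ⟨A, hA, hAw⟩ := (Filter.eventually_prod_self_iff (r := fun x y =>
    ‖score p x.1 x.2 - score p y.1 y.2 - L (x - y)‖ ≤ δ / (‖J‖ + 1) * ‖x - y‖)).1 h1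
  rw [nhds_prod_eq] at hA
  obtain ⟨V, hV, U, hU, hVU⟩ := Filter.mem_prod_iff.1 hA
  -- The maximizer must also be interior, so that its score vanishes.
  have hU' : U ∩ interior Θ ∈ 𝓝 θ₀ :=
    inter_mem hU (isOpen_interior.mem_nhds hreg.mem_interior)
  have h2 := eventually_maximizer_near h hreg hU'
  filter_upwards [((eventually_mem_set.2 hV).and h2).prod_mk (eventually_mem_set.2 hU)]
  rintro ⟨v, θ'⟩ ⟨⟨hv, hmax⟩, hθ'⟩ θ hθ hθmax
  obtain ⟨hθU, hθi⟩ := hmax θ hθ hθmax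
  have h3 := hAw (v, θ) (hVU ⟨hv, hθU⟩) (v, θ') (hVU ⟨hv, hθ'⟩)
  simp only [score_eq_zero_of_isMaxOn h hreg hθi hθmax, Prod.mk_sub_mk, sub_self, hLu,
    Prod.norm_mk, norm_zero, zero_sub, sub_neg_eq_add] at h3
  rw [max_eq_right (norm_nonneg _)] at h3
  have h4 : θ - θ' - J (score p v θ') = J (-score p v θ' + infoOp p θ₀ (γ θ₀) (θ - θ')) := by
    rw [map_add, map_neg, infoInv_infoOp hreg]
    abel
  have h5 : ‖θ - θ' - J (score p v θ')‖ ≤ δ * ‖θ - θ'‖ := by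
    rw [h4]
    calc _ ≤ ‖J‖ * (δ / (‖J‖ + 1) * ‖θ - θ'‖) :=
          (J.le_opNorm _).trans (mul_le_mul_of_nonneg_left h3 (norm_nonneg _))
      _ ≤ (‖J‖ + 1) * (δ / (‖J‖ + 1) * ‖θ - θ'‖) := by gcongr; linarith
      _ = δ * ‖θ - θ'‖ := by field_simp
  have h6 : ‖θ - θ'‖ ≤ ‖θ - θ' - J (score p v θ')‖ + ‖J (score p v θ')‖ := by
    simpa using norm_add_le (θ - θ' - J (score p v θ')) (J (score p v θ'))
  change ‖θ - θ' - J (score p v θ')‖ ≤ ε * ‖J (score p v θ')‖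
  have h7 : δ ≤ ε / 2 := min_le_left _ _
  have h8 : δ ≤ 1 / 2 := min_le_right _ _
  nlinarith [norm_nonneg (θ - θ' - J (score p v θ')), norm_nonneg (J (score p v θ')),
    norm_nonneg (θ - θ')]

end

/-! ### Path probabilities and contiguity -/

/-- The weight of a set of paths. -/
noncomputable def pathProb {T : ℕ} (w : Path T → ℝ) (A : Set (Path T)) : ℝ :=
  ∑ x, w x * A.indicator (fun _ => (1 : ℝ)) x

lemma pathProb_nonneg {T : ℕ} {w : Path T → ℝ} (hw : ∀ x, 0 ≤ w x) (A : Set (Path T)) :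
    0 ≤ pathProb w A :=
  Finset.sum_nonneg fun x _ => mul_nonneg (hw x) (Set.indicator_nonneg (fun _ _ => zero_le_one) x)

/-- Inclusion is required only on possible paths, since the maximum likelihood property reduces to
counts only there. -/
lemma pathProb_mono {T : ℕ} {w : Path T → ℝ} (hw : ∀ x, 0 ≤ w x) {A B : Set (Path T)}
    (h : ∀ x ∈ A, w x ≠ 0 → x ∈ B) : pathProb w A ≤ pathProb w B := by
  refine Finset.sum_le_sum fun x _ => ?_
  by_cases hx : x ∈ A
  · by_cases h0 : w x = 0
    · simp [h0]
    · rw [Set.indicator_of_mem hx, Set.indicator_of_mem (h x hx h0)]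
  · rw [Set.indicator_of_notMem hx, mul_zero]
    exact mul_nonneg (hw x) (Set.indicator_nonneg (fun _ _ => zero_le_one) x)

lemma pathProb_iUnion_le {T : ℕ} {w : Path T → ℝ} (hw : ∀ x, 0 ≤ w x) {ι : Type*} [Fintype ι]
    (A : ι → Set (Path T)) : pathProb w (⋃ i, A i) ≤ ∑ i, pathProb w (A i) := by
  unfold pathProb
  rw [Finset.sum_comm]
  refine Finset.sum_le_sum fun x _ => ?_
  rw [← Finset.mul_sum]
  refine mul_le_mul_of_nonneg_left ?_ (hw x)
  by_cases hx : x ∈ ⋃ i, A i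
  · obtain ⟨i, hi⟩ := Set.mem_iUnion.1 hx
    rw [Set.indicator_of_mem hx]
    calc (1 : ℝ) = (A i).indicator (fun _ => (1 : ℝ)) x := by rw [Set.indicator_of_mem hi]
      _ ≤ _ := Finset.single_le_sum (f := fun i => (A i).indicator (fun _ => (1 : ℝ)) x)
        (fun j _ => Set.indicator_nonneg (fun _ _ => zero_le_one) x) (Finset.mem_univ i)
  · rw [Set.indicator_of_notMem hx]
    exact Finset.sum_nonneg fun j _ => Set.indicator_nonneg (fun _ _ => zero_le_one) x

/-- Chebyshev's inequality. -/
lemma pathProb_sq_le {T : ℕ} {w : Path T → ℝ} (hw : ∀ x, 0 ≤ w x) (X : Path T → ℝ) {ε : ℝ}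
    (hε : 0 < ε) : pathProb w {x | ε ≤ |X x|} ≤ (∑ x, w x * X x ^ 2) / ε ^ 2 := by
  rw [pathProb, Finset.sum_div]
  refine Finset.sum_le_sum fun x _ => ?_
  rw [mul_div_assoc]
  refine mul_le_mul_of_nonneg_left ?_ (hw x)
  by_cases hx : x ∈ {x | ε ≤ |X x|}
  · rw [Set.indicator_of_mem hx, le_div_iff₀ (by positivity), one_mul, ← sq_abs (X x)]
    exact pow_le_pow_left₀ hε.le hx 2
  · rw [Set.indicator_of_notMem hx]
    positivity

/-- Contiguity of the laws of the data when the event probabilities are close. -/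
lemma pathProb_sq_le_of_close {κ : (t : ℕ) → Path t → Bool → ℝ} (hκ : IsGateKernel κ)
    {q q₀ : ℕ → ℝ} {c δ : ℝ} (hc : 0 < c)
    (hq₀ : ∀ t, c ≤ q₀ t ∧ c ≤ 1 - q₀ t) (hδ : ∀ t, (q t - q₀ t) ^ 2 ≤ δ) (T : ℕ)
    (A : Set (Path T)) :
    pathProb (pathMass κ q T) A ^ 2 ≤ (1 + δ / c ^ 2) ^ T * pathProb (pathMass κ q₀ T) A := by
  have hq₀' : ∀ t, q₀ t ∈ Set.Icc (0 : ℝ) 1 := fun t =>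
    ⟨by linarith [(hq₀ t).1], by linarith [(hq₀ t).2]⟩
  -- The one-step factor of the second moment of the likelihood ratio. With an open gate its sum is
  -- one plus a chi-square distance. The denominator vanishes only at a detection through a closed
  -- gate, where the numerator vanishes too.
  let F : ℕ → Bool × Bool → ℝ := fun t a => outcomeMass (q t) a ^ 2 / outcomeMass (q₀ t) a
  have hF0 : ∀ t a, 0 ≤ F t a := fun t a =>
    div_nonneg (sq_nonneg _) (outcomeMass_nonneg (hq₀' t) a)
  have hδ0 : 0 ≤ δ := (sq_nonneg _).trans (hδ 0)
  have hF : ∀ t g, F t (g, true) + F t (g, false) ≤ 1 + δ / c ^ 2 := by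
    intro t g
    cases g
    · simp only [F, outcomeMass]
      simp
      positivity
    · obtain ⟨h1, h2⟩ := hq₀ t
      have h3 : 0 < q₀ t := by linarith
      have h4 : 0 < 1 - q₀ t := by linarith
      have h5 : F t (true, true) + F t (true, false) =
          1 + (q t - q₀ t) ^ 2 / (q₀ t * (1 - q₀ t)) := by
        simp [F, outcomeMass]
        field_simp
        ring
      rw [h5]
      have h6 : c ^ 2 ≤ q₀ t * (1 - q₀ t) := by
        rw [sq]; exact mul_le_mul h1 h2 hc.le h3.le
      gcongr
      exact hδ t
  have hFmul : ∀ t a, F t a * outcomeMass (q₀ t) a = outcomeMass (q t) a ^ 2 := by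
    intro t a
    obtain ⟨h1, h2⟩ := hq₀ t
    have h3 : q₀ t ≠ 0 := by linarith
    have h4 : 1 - q₀ t ≠ 0 := by linarith
    obtain ⟨g, y⟩ := a
    cases g <;> cases y <;> simp [F, outcomeMass, h3, h4]
  have hg := gateMass_nonneg hκ T
  have hi : ∀ x, 0 ≤ A.indicator (fun _ => (1 : ℝ)) x := fun x =>
    Set.indicator_nonneg (fun _ _ => zero_le_one) x
  -- Cauchy–Schwarz for the likelihood ratio times the indicator of `A`. The gating masses agree and
  -- cancel from the ratio.
  have hcs := Finset.sum_sq_le_sum_mul_sum_of_sq_le_mul Finset.univ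
    (r := fun x => pathMass κ q T x * A.indicator (fun _ => (1 : ℝ)) x)
    (f := fun x => gateMass κ T x * ∏ t : Fin T, F t (x t))
    (g := fun x => pathMass κ q₀ T x * A.indicator (fun _ => (1 : ℝ)) x)
    (fun x _ => mul_nonneg (hg x) (Finset.prod_nonneg fun _ _ => hF0 _ _))
    (fun x _ => mul_nonneg (pathMass_nonneg hκ hq₀' T x) (hi x)) (fun x _ => le_of_eq <| by
      have h1 : (∏ t : Fin T, F t (x t)) * ∏ t : Fin T, outcomeMass (q₀ t) (x t) =
          (∏ t : Fin T, outcomeMass (q t) (x t)) ^ 2 := by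
        rw [← Finset.prod_mul_distrib, ← Finset.prod_pow]
        exact Finset.prod_congr rfl fun t _ => hFmul t (x t)
      have h2 : A.indicator (fun _ => (1 : ℝ)) x ^ 2 = A.indicator (fun _ => (1 : ℝ)) x := by
        by_cases hx : x ∈ A <;> simp [hx]
      rw [mul_pow, h2, pathMass, pathMass, mul_pow, ← h1]
      ring)
  refine hcs.trans (mul_le_mul_of_nonneg_right (sum_gateMass_mul_prod_le hκ hF0 hF T) ?_)
  exact pathProb_nonneg (pathMass_nonneg hκ hq₀' T) A

/-! ### Convergence of the frequencies -/

/-- The detection and gate frequencies. -/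
noncomputable def freq (K : ℕ) {T : ℕ} (x : Path T) : (Fin K → ℝ) × (Fin K → ℝ) :=
  ((T : ℝ)⁻¹ • detCount K x, (T : ℝ)⁻¹ • gateCount K x)

/-- Detection counts minus their compensators are small. -/
lemma tendsto_pathProb_detCount_sub {K : ℕ} {κ : (t : ℕ) → Path t → Bool → ℝ}
    (hκ : IsGateKernel κ) {q : ℕ → ℝ} (hq : ∀ t, q t ∈ Set.Icc (0 : ℝ) 1)
    (hqK : ∀ t, q (t % K) = q t) (r : Fin K) {ε : ℝ} (hε : 0 < ε) :
    Tendsto (fun T : ℕ => pathProb (pathMass κ q T)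
      {x | ε ≤ |(T : ℝ)⁻¹ * (detCount K x r - q r * gateCount K x r)|}) atTop (𝓝 0) := by
  -- Martingale differences: detection minus event probability, counted only when the gate is open
  -- in phase `r`.
  let a : ℕ → Bool × Bool → ℝ := fun t b =>
    if t % K = r then (if b.1 then ((if b.2 then 1 else 0) - q t) else 0) else 0
  have h0 : ∀ t g, outcomeMass (q t) (g, true) * a t (g, true) +
      outcomeMass (q t) (g, false) * a t (g, false) = 0 := by
    intro t g
    by_cases ht : t % K = r <;> cases g <;> simp [a, outcomeMass, ht]
    ring
  have h2 : ∀ t b, a t b ^ 2 ≤ 1 := by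
    intro t b
    obtain ⟨h3, h4⟩ := hq t
    rw [sq_le_one_iff_abs_le_one, abs_le]
    simp only [a]
    split_ifs <;> constructor <;> linarith
  have hsum : ∀ (T : ℕ) (x : Path T),
      detCount K x r - q r * gateCount K x r = ∑ t : Fin T, a t (x t) := by
    intro T x
    rw [detCount, gateCount, Finset.mul_sum, ← Finset.sum_sub_distrib]
    refine Finset.sum_congr rfl fun t _ => ?_
    by_cases ht : (t : ℕ) % K = r
    · have : q r = q t := by rw [← hqK t, ht]
      cases hx : (x t).1 <;> cases hy : (x t).2 <;> simp [a, ht, hx, hy, this]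
    · simp [a, ht]
  have hlim : Tendsto (fun T : ℕ => (T : ℝ)⁻¹ / ε ^ 2) atTop (𝓝 0) := by
    simpa using (tendsto_inv_atTop_nhds_zero_nat (𝕜 := ℝ)).div_const (ε ^ 2)
  refine squeeze_zero (fun T => pathProb_nonneg (pathMass_nonneg hκ hq T) _) (fun T => ?_) hlim
  refine (pathProb_sq_le (pathMass_nonneg hκ hq T)
    (fun x => (T : ℝ)⁻¹ * (detCount K x r - q r * gateCount K x r)) hε).trans ?_
  gcongr
  have hb := sum_pathMass_mul_sq_le hκ hq h0 h2 T
  calc ∑ x, pathMass κ q T x * ((T : ℝ)⁻¹ * (detCount K x r - q r * gateCount K x r)) ^ 2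
      = (T : ℝ)⁻¹ ^ 2 * ∑ x, pathMass κ q T x * (∑ t : Fin T, a t (x t)) ^ 2 := by
        rw [Finset.mul_sum]
        refine Finset.sum_congr rfl fun x _ => ?_
        rw [hsum]
        ring
    _ ≤ (T : ℝ)⁻¹ ^ 2 * (1 * T) := by gcongr
    _ ≤ (T : ℝ)⁻¹ := by
        rcases Nat.eq_zero_or_pos T with rfl | hT
        · simp
        · have : (T : ℝ) ≠ 0 := by positivity
          field_simp
          exact le_rfl

/-- The number of times `t < T` in phase `r` is `(T - r)/K` rounded up, written without truncated
subtraction of `r` from `T`. It grows exactly when `T` itself is in phase `r`. -/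
lemma sum_range_phase {M : Type*} [AddCommMonoid M] {K r : ℕ} (hr : r < K) (f : ℕ → M) (T : ℕ) :
    ∑ t ∈ Finset.range T, (if t % K = r then f t else 0) =
      ∑ l ∈ Finset.range ((T + (K - 1 - r)) / K), f (r + l * K) := by
  induction T with
  | zero =>
    rw [Nat.div_eq_of_lt (by omega)]
    simp
  | succ T ih =>
    rw [Finset.sum_range_succ, ih, Nat.add_right_comm T 1, Nat.succ_div]
    by_cases h : T % K = r
    · have h1 : T = r + T / K * K := by rw [← h, Nat.mul_comm]; exact (Nat.mod_add_div T K).symm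
      have h2 : T + (K - 1 - r) = K - 1 + T / K * K := by omega
      have h3 : (T + (K - 1 - r)) / K = T / K := by
        rw [h2, Nat.add_mul_div_right _ _ (by omega), Nat.div_eq_of_lt (by omega), zero_add]
      have h4 : K ∣ T + (K - 1 - r) + 1 := by
        rw [h2]
        exact ⟨T / K + 1, by rw [Nat.mul_add, Nat.mul_comm K]; omega⟩
      rw [if_pos h, if_pos h4, Finset.sum_range_succ, h3, ← h1]
    · have h4 : ¬ K ∣ T + (K - 1 - r) + 1 := by
        rintro ⟨m, hm⟩
        apply h
        have hm1 : m ≠ 0 := by rintro rfl; omega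
        obtain ⟨m, rfl⟩ := Nat.exists_eq_succ_of_ne_zero hm1
        have : T = r + K * m := by
          rw [Nat.mul_succ] at hm; omega
        rw [this, Nat.add_mul_mod_self_left, Nat.mod_eq_of_lt hr]
      rw [if_neg h, if_neg h4, add_zero, add_zero]

lemma tendsto_phase_length {K : ℕ} (hK : 0 < K) (j : ℕ) :
    Tendsto (fun T : ℕ => (((T + j) / K : ℕ) : ℝ) / T) atTop (𝓝 (1 / K)) := by
  have h1 : Tendsto (fun T : ℕ => (((T + j) / K : ℕ) : ℝ) / ((T + j : ℕ) : ℝ)) atTop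
      (𝓝 (1 / K)) := by
    have h := (tendsto_nat_floor_mul_div_atTop (R := ℝ) (a := 1 / K) (by positivity)).comp
      ((tendsto_natCast_atTop_atTop (R := ℝ)).comp (tendsto_add_atTop_nat j))
    refine h.congr fun T => ?_
    simp only [Function.comp]
    rw [one_div_mul_eq_div, Nat.floor_div_natCast, Nat.floor_natCast]
  have h2 : Tendsto (fun T : ℕ => ((T + j : ℕ) : ℝ) / T) atTop (𝓝 1) := by
    have : Tendsto (fun T : ℕ => 1 + (j : ℝ) / T) atTop (𝓝 (1 + 0)) :=
      tendsto_const_nhds.add (tendsto_const_div_atTop_nhds_zero_nat _)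
    rw [add_zero] at this
    refine this.congr' ?_
    filter_upwards [eventually_gt_atTop 0] with T hT
    have : (T : ℝ) ≠ 0 := by positivity
    push_cast
    field_simp
  have h3 := h1.mul h2
  rw [mul_one] at h3
  refine h3.congr' ?_
  filter_upwards [eventually_gt_atTop 0] with T hT
  have : (T : ℝ) ≠ 0 := by positivity
  have : ((T + j : ℕ) : ℝ) ≠ 0 := by positivity
  field_simp

lemma gateCount_obs {Ω : Type*} {K : ℕ} (G Y : ℕ → Ω → Bool) (T : ℕ) (r : Fin K) (ω : Ω) :
    gateCount K (obs G Y T ω) r =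
      ∑ l ∈ Finset.range ((T + (K - 1 - r)) / K), if G (r + l * K) ω = true then (1 : ℝ) else 0 := by
  rw [← sum_range_phase r.2 (fun t => if G t ω = true then (1 : ℝ) else 0), gateCount,
    Finset.sum_range]
  rfl

lemma tendsto_localParam {d : ℕ} (θ₀ u : Param d) :
    Tendsto (fun T : ℕ => θ₀ + (√(T : ℝ))⁻¹ • u) atTop (𝓝 θ₀) := by
  have h1 : Tendsto (fun T : ℕ => (√(T : ℝ))⁻¹) atTop (𝓝 0) :=
    tendsto_inv_atTop_zero.comp (Real.tendsto_sqrt_atTop.comp tendsto_natCast_atTop_atTop)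
  simpa using tendsto_const_nhds.add (h1.smul_const u)

section

variable {d K D : ℕ} {Ω : Type*} [MeasurableSpace Ω] {Θ : Set (Param d)} {p : ℕ → Param d → ℝ}
  {Φ : (t : ℕ) → Path t × unitInterval → Bool} {γ : Param d → Fin K → ℝ}
  {P : Param d → Measure Ω} [∀ θ, IsProbabilityMeasure (P θ)] {G Y : ℕ → Ω → Bool}
  {θ₀ θ : Param d}

lemma tendsto_pathProb_gateCount (h : IsDEDProcess Θ K D p Φ γ P G Y) (hθ : θ ∈ Θ) (r : Fin K)
    {ε : ℝ} (hε : 0 < ε) :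
    Tendsto (fun T : ℕ => pathProb (pathMass (gateProb Φ) (fun t => p t θ) T)
      {x | ε ≤ |(T : ℝ)⁻¹ * gateCount K x r - γ θ r / K|}) atTop (𝓝 0) := by
  have hlaw := h.law θ hθ
  have hK := h.period_pos
  set Lr : ℕ → ℕ := fun T => (T + (K - 1 - r)) / K
  have hLr : Tendsto Lr atTop atTop :=
    (Nat.tendsto_div_const_atTop hK.ne').comp (tendsto_add_atTop_nat _)
  have h1 := (hlaw.gating_frequency r).comp hLr
  rw [tendstoInMeasure_iff_measureReal_norm] at h1
  have hlen := tendsto_phase_length hK (K - 1 - r)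
  have hK1 : (1 : ℝ) ≤ K := by exact_mod_cast hK
  obtain ⟨hγ0, hγ1⟩ := hlaw.freq_mem r
  -- The bound `1` yields `Lr T / T ≤ 2` and the bound `ε / 2` controls the error of the phase
  -- length. A deviation of `ε` in the count thus forces one of at least `ε / 4` in the phase
  -- average.
  have hlen1 : ∀ᶠ T : ℕ in atTop, |(Lr T : ℝ) / T - 1 / K| < min (ε / 2) 1 := by
    have := (Metric.tendsto_nhds.1 hlen) _ (lt_min (half_pos hε) one_pos)
    simpa [Real.dist_eq] using this
  refine squeeze_zero' (Eventually.of_forall fun T => pathProb_nonneg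
    (pathMass_nonneg (isGateKernel_gateProb h.measurable_rule) hlaw.prob_mem T) _) ?_
    (h1 (ε / 4) (by positivity))
  filter_upwards [hlen1, hLr.eventually_gt_atTop 0, eventually_gt_atTop 0] with T hT hLT hT0
  rw [← show (P θ).real (obs G Y T ⁻¹' {x | ε ≤ |(T : ℝ)⁻¹ * gateCount K x r - γ θ r / K|}) =
    pathProb (pathMass (gateProb Φ) (fun t => p t θ) T) _ from
    hlaw.measureReal_preimage_obs h.measurable_rule h.measurable_gate h.measurable_outcome _]
  refine measureReal_mono ?_ (measure_ne_top _ _)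
  intro ω hω
  have hω : ε ≤ |(T : ℝ)⁻¹ * gateCount K (obs G Y T ω) r - γ θ r / K| := hω
  change ε / 4 ≤ ‖1 / (Lr T : ℝ) * _ - γ θ r‖
  rw [gateCount_obs] at hω
  set S := ∑ l ∈ Finset.range (Lr T), if G (r + l * K) ω = true then (1 : ℝ) else 0
  have hLT' : (0 : ℝ) < Lr T := by exact_mod_cast hLT
  have hT0' : (0 : ℝ) < T := by exact_mod_cast hT0
  have e1 : (T : ℝ)⁻¹ * S - γ θ r / K = (Lr T : ℝ) / T * (1 / (Lr T : ℝ) * S - γ θ r) +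
      γ θ r * ((Lr T : ℝ) / T - 1 / K) := by
    field_simp
    ring
  have hT1 := lt_of_lt_of_le hT (min_le_left _ _)
  have hT2 := abs_lt.1 (lt_of_lt_of_le hT (min_le_right _ _))
  have hK2 : 1 / (K : ℝ) ≤ 1 := by rw [div_le_one (by positivity)]; exact hK1
  have e2 : |(T : ℝ)⁻¹ * S - γ θ r / K| ≤ 2 * |1 / (Lr T : ℝ) * S - γ θ r| + ε / 2 := by
    rw [e1]
    refine (abs_add_le _ _).trans (add_le_add ?_ ?_)
    · rw [abs_mul, abs_of_pos (by positivity)]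
      gcongr
      linarith [hT2.2]
    · rw [abs_mul, abs_of_nonneg hγ0]
      calc _ ≤ 1 * (ε / 2) := mul_le_mul hγ1 hT1.le (abs_nonneg _) zero_le_one
        _ = _ := one_mul _
  rw [Real.norm_eq_abs]
  linarith

/-- Under the truth, the frequencies converge to their limits. -/
lemma tendsto_pathProb_freq (h : IsDEDProcess Θ K D p Φ γ P G Y) (hθ : θ₀ ∈ Θ)
    {U : Set ((Fin K → ℝ) × (Fin K → ℝ))} (hU : U ∈ 𝓝 (limitFreq p γ θ₀)) :
    Tendsto (fun T : ℕ => pathProb (pathMass (gateProb Φ) (fun t => p t θ₀) T)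
      {x | freq K x ∉ U}) atTop (𝓝 0) := by
  have hκ := isGateKernel_gateProb h.measurable_rule
  have hq := h.mem_Icc hθ
  -- Recovers the frequencies from the compensated detections and the gate frequencies, whose limits
  -- are known separately.
  let Ψ : (Fin K → ℝ) × (Fin K → ℝ) → (Fin K → ℝ) × (Fin K → ℝ) := fun v =>
    (fun r => v.1 r + p r θ₀ * v.2 r, v.2)
  have hΨ : Continuous Ψ := by fun_prop
  have hΨ0 : Ψ (0, fun r => γ θ₀ r / K) = limitFreq p γ θ₀ := by
    simp only [Ψ, limitFreq]
    refine Prod.ext (funext fun r => ?_) rfl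
    simp [mul_comm]
  have hmem : Ψ ⁻¹' U ∈ 𝓝 ((0, fun r => γ θ₀ r / K) : (Fin K → ℝ) × (Fin K → ℝ)) :=
    hΨ.continuousAt (by rw [hΨ0]; exact hU)
  obtain ⟨ε, hε, hball⟩ := Metric.mem_nhds_iff.1 hmem
  let A : (T : ℕ) → Fin K → Set (Path T) := fun T r =>
    {x | ε ≤ |(T : ℝ)⁻¹ * (detCount K x r - p r θ₀ * gateCount K x r)|}
  let B : (T : ℕ) → Fin K → Set (Path T) := fun T r =>
    {x | ε ≤ |(T : ℝ)⁻¹ * gateCount K x r - γ θ₀ r / K|}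
  have hAB : Tendsto (fun T : ℕ =>
      ∑ i : Fin K ⊕ Fin K, pathProb (pathMass (gateProb Φ) (fun t => p t θ₀) T)
        (Sum.elim (A T) (B T) i)) atTop (𝓝 0) := by
    rw [← Finset.sum_const_zero (ι := Fin K ⊕ Fin K) (s := Finset.univ)]
    refine tendsto_finsetSum _ fun i _ => ?_
    rcases i with r | r
    · exact tendsto_pathProb_detCount_sub hκ hq (fun t => h.apply_mod hθ t) r hε
    · exact tendsto_pathProb_gateCount h hθ r hε
  refine squeeze_zero (fun T => pathProb_nonneg (pathMass_nonneg hκ hq T) _) (fun T => ?_) hAB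
  refine (pathProb_mono (pathMass_nonneg hκ hq T) ?_).trans
    (pathProb_iUnion_le (pathMass_nonneg hκ hq T) _)
  intro x hx _
  by_contra hcon
  simp only [Set.mem_iUnion, not_exists, Sum.forall, Sum.elim_inl, Sum.elim_inr] at hcon
  obtain ⟨hA, hB⟩ := hcon
  refine hx ?_
  have hv : ((fun r => (T : ℝ)⁻¹ * (detCount K x r - p r θ₀ * gateCount K x r),
      fun r => (T : ℝ)⁻¹ * gateCount K x r) : (Fin K → ℝ) × (Fin K → ℝ)) ∈
      Metric.ball ((0, fun r => γ θ₀ r / K) : (Fin K → ℝ) × (Fin K → ℝ)) ε := by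
    rw [Metric.mem_ball, Prod.dist_eq, max_lt_iff, dist_pi_lt_iff hε, dist_pi_lt_iff hε]
    refine ⟨fun r => ?_, fun r => ?_⟩
    · rw [Real.dist_eq]
      simp only [Pi.zero_apply, sub_zero]
      exact not_le.1 (hA r)
    · rw [Real.dist_eq]
      exact not_le.1 (hB r)
  have hv' := hball hv
  have hfreq : freq K x = Ψ (fun r => (T : ℝ)⁻¹ * (detCount K x r - p r θ₀ * gateCount K x r),
      fun r => (T : ℝ)⁻¹ * gateCount K x r) := by
    simp only [freq, Ψ]
    refine Prod.ext (funext fun r => ?_) (funext fun r => ?_)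
    · simp only [Pi.smul_apply, smul_eq_mul]; ring
    · simp
  rw [hfreq]
  exact hv'

/-- The frequencies converge also under local alternatives. -/
lemma tendsto_pathProb_freq_local (h : IsDEDProcess Θ K D p Φ γ P G Y)
    (hreg : RegularityAt Θ p γ θ₀) (u : Param d)
    {U : Set ((Fin K → ℝ) × (Fin K → ℝ))} (hU : U ∈ 𝓝 (limitFreq p γ θ₀)) :
    Tendsto (fun T : ℕ =>
      pathProb (pathMass (gateProb Φ) (fun t => p t (θ₀ + (√(T : ℝ))⁻¹ • u)) T)
      {x | freq K x ∉ U}) atTop (𝓝 0) := by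
  have hκ := isGateKernel_gateProb h.measurable_rule
  have hθ₀ : θ₀ ∈ Θ := interior_subset hreg.mem_interior
  obtain ⟨c, hc, hb⟩ := exists_prob_bounds h hreg
  have hθT := tendsto_localParam θ₀ u
  have hmem : ∀ᶠ T : ℕ in atTop, θ₀ + (√(T : ℝ))⁻¹ • u ∈ Θ :=
    hθT.eventually_mem (mem_interior_iff_mem_nhds.1 hreg.mem_interior)
  have hlip : ∀ r : Fin K, ∃ C, ∀ᶠ θ in 𝓝 θ₀, |p r θ - p r θ₀| ≤ C * ‖θ - θ₀‖ := by
    intro r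
    have := (hasStrictFDerivAt_prob h hreg hreg.mem_interior r).hasFDerivAt.isBigO_sub
    obtain ⟨C, hC⟩ := this.bound
    exact ⟨C, hC⟩
  choose C hC using hlip
  let M := ∑ r, |C r|
  -- A shift of order `1/√T` moves each event probability by the same order. The chi-square cost per
  -- step is then of order `1/T`, so the product over `T` steps stays below `exp N`.
  have hM : ∀ᶠ T : ℕ in atTop, ∀ r : Fin K,
      (p r (θ₀ + (√(T : ℝ))⁻¹ • u) - p r θ₀) ^ 2 ≤ (M * ‖u‖) ^ 2 / T := by
    rw [eventually_all]
    intro r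
    filter_upwards [hθT.eventually (hC r)] with T hT
    rw [add_sub_cancel_left, norm_smul, norm_inv, Real.norm_of_nonneg (Real.sqrt_nonneg _)] at hT
    have h1 : |p r (θ₀ + (√(T : ℝ))⁻¹ • u) - p r θ₀| ≤ M * ((√(T : ℝ))⁻¹ * ‖u‖) := by
      refine hT.trans (mul_le_mul_of_nonneg_right ?_ (by positivity))
      exact (le_abs_self _).trans (Finset.single_le_sum (f := fun r => |C r|)
        (fun _ _ => abs_nonneg _) (Finset.mem_univ r))
    rw [← sq_abs]
    refine (pow_le_pow_left₀ (abs_nonneg _) h1 2).trans (le_of_eq ?_)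
    rw [mul_pow, mul_pow, inv_pow, Real.sq_sqrt (Nat.cast_nonneg T)]
    ring
  let N := (M * ‖u‖) ^ 2 / c ^ 2
  have hlim : Tendsto (fun T : ℕ => √(Real.exp N *
      pathProb (pathMass (gateProb Φ) (fun t => p t θ₀) T) {x | freq K x ∉ U})) atTop (𝓝 0) := by
    have := ((tendsto_pathProb_freq h hθ₀ hU).const_mul (Real.exp N)).sqrt
    simpa using this
  refine squeeze_zero' ?_ ?_ hlim
  · filter_upwards [hmem] with T hT
    exact pathProb_nonneg (pathMass_nonneg hκ (h.mem_Icc hT) T) _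
  · filter_upwards [hmem, hM, eventually_gt_atTop 0] with T hT hMT hT0
    have hp0 := pathProb_nonneg (pathMass_nonneg hκ (h.mem_Icc hθ₀) T)
      {x : Path T | freq K x ∉ U}
    refine Real.le_sqrt_of_sq_le ?_
    refine (pathProb_sq_le_of_close hκ hc (hb θ₀ hθ₀)
      (δ := (M * ‖u‖) ^ 2 / T) (fun t => ?_) T _).trans ?_
    · rw [← h.apply_mod hT t, ← h.apply_mod hθ₀ t]
      exact hMT ⟨t % K, Nat.mod_lt _ h.period_pos⟩
    · refine mul_le_mul_of_nonneg_right ?_ hp0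
      have hT0' : (T : ℝ) ≠ 0 := by positivity
      calc (1 + (M * ‖u‖) ^ 2 / T / c ^ 2) ^ T ≤ (Real.exp ((M * ‖u‖) ^ 2 / T / c ^ 2)) ^ T := by
            refine pow_le_pow_left₀ (by positivity) ?_ T
            rw [add_comm]
            exact Real.add_one_le_exp _
        _ = Real.exp N := by
            rw [← Real.exp_nat_mul]
            congr 1
            simp only [N]
            field_simp

end

/-! ### Central limit theorem for the score -/

lemma tendsto_mul_exp_sub_one_sub {α : ℕ → ℝ} {a : ℝ} (hα : Tendsto α atTop (𝓝 a)) :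
    Tendsto (fun T : ℕ => (T : ℂ) * (Complex.exp (((√(T : ℝ))⁻¹ * α T : ℝ) * Complex.I) - 1 -
      ((√(T : ℝ))⁻¹ * α T : ℝ) * Complex.I)) atTop (𝓝 (-a ^ 2 / 2)) := by
  have hs : Tendsto (fun T : ℕ => (√(T : ℝ))⁻¹) atTop (𝓝 0) :=
    tendsto_inv_atTop_zero.comp (Real.tendsto_sqrt_atTop.comp tendsto_natCast_atTop_atTop)
  set z : ℕ → ℂ := fun T => ((√(T : ℝ))⁻¹ * α T : ℝ) * Complex.I
  have hz : Tendsto z atTop (𝓝 0) := by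
    have h := (Complex.continuous_ofReal.tendsto _).comp (hs.mul hα)
    simpa [z] using h.mul_const Complex.I
  have hT2 : ∀ᶠ T : ℕ in atTop, (T : ℂ) * z T ^ 2 = -(α T : ℂ) ^ 2 := by
    filter_upwards [eventually_gt_atTop 0] with T hT
    have h1 : (((√(T : ℝ))⁻¹ : ℝ) : ℂ) ^ 2 = (T : ℂ)⁻¹ := by
      rw [← Complex.ofReal_pow, inv_pow, Real.sq_sqrt (Nat.cast_nonneg T)]
      simp
    have h2 : (T : ℂ) ≠ 0 := by exact_mod_cast hT.ne'
    simp only [z]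
    rw [Complex.ofReal_mul, mul_pow, mul_pow, Complex.I_sq, h1]
    field_simp
  have hαc : Tendsto (fun T => -(α T : ℂ) ^ 2) atTop (𝓝 (-(a : ℂ) ^ 2)) :=
    (((Complex.continuous_ofReal.tendsto _).comp hα).pow 2).neg
  have hlim2 : Tendsto (fun T : ℕ => (T : ℂ) * z T ^ 2) atTop (𝓝 (-(a : ℂ) ^ 2)) :=
    hαc.congr' (hT2.mono fun T h => h.symm)
  have ho := (Complex.exp_sub_sum_range_succ_isLittleO_pow 2).comp_tendsto hz
  have ho2 := (Asymptotics.isBigO_refl (fun T : ℕ => (T : ℂ)) atTop).mul_isLittleO ho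
  have hrem := (Asymptotics.isLittleO_one_iff ℝ).1 (ho2.trans_isBigO (hlim2.isBigO_one ℝ))
  have h := hrem.add (hlim2.div_const 2)
  rw [zero_add] at h
  refine h.congr fun T => ?_
  simp [Finset.sum_range_succ, z]
  ring

/-- The one-step characteristic function of the score at an open gate. The increments `(1/q - 1) c`
and `-c` have mean zero, so the linear terms cancel, and their variance is `(1 - q)/q * c²`. -/
lemma tendsto_mul_log_charFun {q c : ℕ → ℝ} {q₀ c₀ : ℝ} (hq : Tendsto q atTop (𝓝 q₀))
    (hc : Tendsto c atTop (𝓝 c₀)) (hq₀ : q₀ ≠ 0) :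
    Tendsto (fun T : ℕ => (T : ℂ) * ((q T : ℂ) *
        Complex.exp (((√(T : ℝ))⁻¹ * (((q T)⁻¹ - 1) * c T) : ℝ) * Complex.I) +
        (1 - q T : ℂ) * Complex.exp (((√(T : ℝ))⁻¹ * -c T : ℝ) * Complex.I) - 1)) atTop
      (𝓝 (-(((1 - q₀) / q₀ * c₀ ^ 2 : ℝ) : ℂ) / 2)) := by
  have h1 := tendsto_mul_exp_sub_one_sub (((hq.inv₀ hq₀).sub_const 1).mul hc)
  have h2 := tendsto_mul_exp_sub_one_sub hc.neg
  have hqc : Tendsto (fun T => (q T : ℂ)) atTop (𝓝 (q₀ : ℂ)) :=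
    (Complex.continuous_ofReal.tendsto _).comp hq
  have h3 := (hqc.mul h1).add ((hqc.const_sub 1).mul h2)
  have hq₀' : (q₀ : ℂ) ≠ 0 := by exact_mod_cast hq₀
  have e : (q₀ : ℂ) * (-(((q₀⁻¹ - 1) * c₀ : ℝ) : ℂ) ^ 2 / 2) +
      (1 - q₀ : ℂ) * (-((-c₀ : ℝ) : ℂ) ^ 2 / 2) =
      -(((1 - q₀) / q₀ * c₀ ^ 2 : ℝ) : ℂ) / 2 := by
    push_cast
    field_simp
    ring
  rw [← e]
  refine h3.congr' ?_
  filter_upwards [hq.eventually_ne hq₀] with T hT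
  have hT' : (q T : ℂ) ≠ 0 := by exact_mod_cast hT
  push_cast
  field_simp
  ring

lemma gateCount_nonneg {K T : ℕ} (x : Path T) (r : Fin K) : 0 ≤ gateCount K x r :=
  Finset.sum_nonneg fun t _ => by split_ifs <;> norm_num

lemma gateCount_le {K T : ℕ} (x : Path T) (r : Fin K) : gateCount K x r ≤ T := by
  calc gateCount K x r ≤ ∑ _t : Fin T, (1 : ℝ) :=
        Finset.sum_le_sum fun t _ => by split_ifs <;> norm_num
    _ = T := by simp

/-- Averages of functions that are bounded, and small relative to `g` where `V` is near `v₀`,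
vanish in the limit. -/
lemma tendsto_sum_weight_mul {E : Type*} [TopologicalSpace E] {m : (T : ℕ) → Path T → ℝ}
    {V : (T : ℕ) → Path T → E} {v₀ : E} {f : (T : ℕ) → Path T → ℂ} {g : (T : ℕ) → Path T → ℝ}
    {B C : ℝ} (hm : ∀ᶠ T in atTop, ∀ x, 0 ≤ m T x)
    (hV : ∀ U ∈ 𝓝 v₀, Tendsto (fun T => pathProb (m T) {x | V T x ∉ U}) atTop (𝓝 0))
    (hg : ∀ T x, 0 ≤ g T x) (hgB : ∀ᶠ T in atTop, ∑ x, m T x * g T x ≤ B)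
    (hC : ∀ᶠ T in atTop, ∀ x, ‖f T x‖ ≤ C)
    (hf : ∀ ε > 0, ∃ U ∈ 𝓝 v₀, ∀ᶠ T in atTop, ∀ x, m T x ≠ 0 → V T x ∈ U →
      ‖f T x‖ ≤ ε * g T x) :
    Tendsto (fun T => ∑ x, (m T x : ℂ) * f T x) atTop (𝓝 0) := by
  rw [Metric.tendsto_nhds]
  intro ε hε
  have hB : 0 < |B| + 1 := by positivity
  have hC0 : 0 < |C| + 1 := by positivity
  obtain ⟨U, hU, hfU⟩ := hf (ε / 2 / (|B| + 1)) (by positivity)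
  have hVU := (Metric.tendsto_nhds.1 (hV U hU)) (ε / 2 / (|C| + 1)) (by positivity)
  filter_upwards [hm, hgB, hC, hfU, hVU] with T hm hgB hC hfU hVU
  rw [dist_zero_right] at hVU ⊢
  have hbound : ∀ x, ‖(m T x : ℂ) * f T x‖ ≤ ε / 2 / (|B| + 1) * (m T x * g T x) +
      (|C| + 1) * (m T x * {x | V T x ∉ U}.indicator (fun _ => (1 : ℝ)) x) := by
    intro x
    rw [norm_mul, Complex.norm_real, Real.norm_of_nonneg (hm x)]
    have e1 : 0 ≤ ε / 2 / (|B| + 1) * (m T x * g T x) :=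
      mul_nonneg (by positivity) (mul_nonneg (hm x) (hg T x))
    by_cases hx : x ∈ {x | V T x ∉ U}
    · rw [Set.indicator_of_mem hx]
      have : m T x * ‖f T x‖ ≤ m T x * (|C| + 1) :=
        mul_le_mul_of_nonneg_left ((hC x).trans ((le_abs_self C).trans (by linarith))) (hm x)
      linarith
    · rw [Set.indicator_of_notMem hx, mul_zero, mul_zero, add_zero]
      by_cases h0 : m T x = 0
      · simp [h0]
      · have := mul_le_mul_of_nonneg_left (hfU x h0 (not_not.1 hx)) (hm x)
        linarith
  calc ‖∑ x, (m T x : ℂ) * f T x‖ ≤ ∑ x, ‖(m T x : ℂ) * f T x‖ := norm_sum_le _ _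
    _ ≤ ∑ x, (ε / 2 / (|B| + 1) * (m T x * g T x) +
      (|C| + 1) * (m T x * {x | V T x ∉ U}.indicator (fun _ => (1 : ℝ)) x)) :=
        Finset.sum_le_sum fun x _ => hbound x
    _ = ε / 2 / (|B| + 1) * (∑ x, m T x * g T x) +
      (|C| + 1) * pathProb (m T) {x | V T x ∉ U} := by
        rw [Finset.sum_add_distrib, ← Finset.mul_sum, ← Finset.mul_sum, pathProb]
    _ < ε / 2 + ε / 2 := by
        refine add_lt_add_of_le_of_lt ?_ ?_
        · calc _ ≤ ε / 2 / (|B| + 1) * (|B| + 1) := by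
                gcongr
                exact hgB.trans ((le_abs_self B).trans (by linarith))
            _ = ε / 2 := by field_simp
        · calc _ < (|C| + 1) * (ε / 2 / (|C| + 1)) := by
                gcongr
                exact (le_abs_self _).trans_lt hVU
            _ = ε / 2 := by field_simp
    _ = ε := by ring

/-- The increments of the score in direction `w`. -/
noncomputable def scoreIncr {d : ℕ} (K : ℕ) (p : ℕ → Param d → ℝ) (θ w : Param d) (t : ℕ)
    (b : Bool × Bool) : ℝ :=
  if b.1 then (if b.2 then ((p (t % K) θ)⁻¹ - 1) * inner ℝ w (gradient (rate p (t % K)) θ)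
    else -inner ℝ w (gradient (rate p (t % K)) θ)) else 0

lemma inner_score {d K : ℕ} (hK : 0 < K) (p : ℕ → Param d → ℝ) (θ w : Param d) {T : ℕ}
    (x : Path T) :
    inner ℝ w (score p (detCount K x, gateCount K x) θ) =
      ∑ t : Fin T, scoreIncr K p θ w t (x t) := by
  have h := sum_phase hK x (fun r => ((p r θ)⁻¹ - 1) * inner ℝ w (gradient (rate p r) θ))
    (fun r => -inner ℝ w (gradient (rate p r) θ))
  rw [score, inner_sum]
  unfold scoreIncr
  rw [h]
  refine Finset.sum_congr rfl fun r _ => ?_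
  rw [inner_smul_right]
  simp only [smul_eq_mul]
  ring

/-- The score is linear in the counts, and `√T / T = 1/√T`, also at `T = 0` by convention. -/
lemma score_freq {d K : ℕ} (p : ℕ → Param d → ℝ) (θ : Param d) {T : ℕ} (x : Path T) :
    √(T : ℝ) • score p (freq K x) θ =
      (√(T : ℝ))⁻¹ • score p (detCount K x, gateCount K x) θ := by
  have h : √(T : ℝ) * (T : ℝ)⁻¹ = (√(T : ℝ))⁻¹ := by
    rw [← div_eq_mul_inv, Real.sqrt_div_self]
  rw [← h, ← smul_smul, score, score, Finset.smul_sum (s := Finset.univ) (r := (T : ℝ)⁻¹)]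
  congr 1
  refine Finset.sum_congr rfl fun r _ => ?_
  rw [smul_smul]
  congr 1
  simp only [freq, Pi.smul_apply, smul_eq_mul]
  ring

section

variable {d K D : ℕ} {Ω : Type*} [MeasurableSpace Ω] {Θ : Set (Param d)} {p : ℕ → Param d → ℝ}
  {Φ : (t : ℕ) → Path t × unitInterval → Bool} {γ : Param d → Fin K → ℝ}
  {P : Param d → Measure Ω} {G Y : ℕ → Ω → Bool}
  {θ₀ θ : Param d}

lemma eventually_localParam_mem (hreg : RegularityAt Θ p γ θ₀) (u : Param d) :
    ∀ᶠ T : ℕ in atTop, θ₀ + (√(T : ℝ))⁻¹ • u ∈ Θ :=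
  (tendsto_localParam θ₀ u).eventually_mem (mem_interior_iff_mem_nhds.1 hreg.mem_interior)

lemma tendsto_gradient_localParam (hreg : RegularityAt Θ p γ θ₀) (u : Param d) (r : Fin K) :
    Tendsto (fun T : ℕ => gradient (rate p r) (θ₀ + (√(T : ℝ))⁻¹ • u)) atTop
      (𝓝 (gradient (rate p r) θ₀)) :=
  (contDiffAt_gradient_rate hreg hreg.mem_interior r).continuousAt.tendsto.comp
    (tendsto_localParam θ₀ u)

/-- The normalized score is bounded in `L¹`. -/
lemma exists_sum_norm_score_le (h : IsDEDProcess Θ K D p Φ γ P G Y)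
    (hreg : RegularityAt Θ p γ θ₀) (u : Param d) :
    ∃ B, ∀ᶠ T : ℕ in atTop,
      ∑ x : Path T, pathMass (gateProb Φ) (fun t => p t (θ₀ + (√(T : ℝ))⁻¹ • u)) T x *
        ‖√(T : ℝ) • score p (freq K x) (θ₀ + (√(T : ℝ))⁻¹ • u)‖ ≤ B := by
  have hκ := isGateKernel_gateProb h.measurable_rule
  obtain ⟨c, hc, hb⟩ := exists_prob_bounds h hreg
  let M := ∑ r : Fin K, (‖gradient (rate p r) θ₀‖ + 1)
  have hM : ∀ᶠ T : ℕ in atTop, ∀ r : Fin K,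
      ‖gradient (rate p r) (θ₀ + (√(T : ℝ))⁻¹ • u)‖ ≤ M := by
    rw [eventually_all]
    intro r
    filter_upwards [(tendsto_gradient_localParam hreg u r).norm.eventually_le_const
      (lt_add_one _)] with T hT
    exact hT.trans (Finset.single_le_sum
      (f := fun r : Fin K => ‖gradient (rate p r) θ₀‖ + 1) (fun _ _ => by positivity)
      (Finset.mem_univ r))
  -- From `‖s‖ ≤ 1 + ‖s‖²`: each coordinate of the score is a martingale with increments bounded by
  -- `c⁻¹ * M`.
  refine ⟨1 + ∑ _i : Fin d, (c⁻¹ * M) ^ 2, ?_⟩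
  filter_upwards [hM, eventually_localParam_mem hreg u, eventually_gt_atTop 0] with T hMT hT hT0
  set θ := θ₀ + (√(T : ℝ))⁻¹ • u
  have hmn := pathMass_nonneg hκ (h.mem_Icc hT) T
  have hcoord : ∀ i : Fin d, ∑ x : Path T, pathMass (gateProb Φ) (fun t => p t θ) T x *
      (√(T : ℝ) • score p (freq K x) θ) i ^ 2 ≤ (c⁻¹ * M) ^ 2 := by
    intro i
    set e : Param d := EuclideanSpace.single i 1
    have h0 : ∀ t g, outcomeMass (p t θ) (g, true) * scoreIncr K p θ e t (g, true) +
        outcomeMass (p t θ) (g, false) * scoreIncr K p θ e t (g, false) = 0 := by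
      intro t g
      have hp : p t θ ≠ 0 := (hc.trans_le (hb θ hT t).1).ne'
      cases g
      · simp [scoreIncr]
      · simp only [scoreIncr, outcomeMass, h.apply_mod hT]
        simp
        field_simp
        ring
    have h2 : ∀ t b, scoreIncr K p θ e t b ^ 2 ≤ (c⁻¹ * M) ^ 2 := by
      intro t b
      obtain ⟨h3, h4⟩ := hb θ hT (t % K)
      have hin : |inner ℝ e (gradient (rate p (t % K)) θ)| ≤ M := by
        refine (abs_real_inner_le_norm _ _).trans ?_
        have : ‖e‖ = 1 := by simp [e]
        rw [this, one_mul]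
        exact hMT ⟨t % K, Nat.mod_lt _ h.period_pos⟩
      have hM0 : 0 ≤ M := (abs_nonneg _).trans hin
      have hc1 : 1 ≤ c⁻¹ := by
        rw [one_le_inv₀ hc]
        linarith
      have h5 : (p (t % K) θ)⁻¹ ≤ c⁻¹ := by gcongr
      have h6 : 1 ≤ (p (t % K) θ)⁻¹ := by
        rw [one_le_inv₀ (by linarith)]
        linarith
      refine sq_le_sq' ?_ ?_ <;> [apply neg_le_of_abs_le; apply le_of_abs_le] <;>
      · unfold scoreIncr
        split_ifs
        · rw [abs_mul]
          refine mul_le_mul ?_ hin (abs_nonneg _) (by positivity)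
          rw [abs_of_nonneg (by linarith)]
          linarith
        · rw [abs_neg]
          calc _ ≤ 1 * M := by rw [one_mul]; exact hin
            _ ≤ _ := by gcongr
        · rw [abs_zero]
          positivity
    have hs := sum_pathMass_mul_sq_le hκ (h.mem_Icc hT) h0 h2 T
    have hT0' : (T : ℝ) ≠ 0 := by positivity
    have hxi : ∀ x : Path T, (√(T : ℝ) • score p (freq K x) θ) i ^ 2 =
        (T : ℝ)⁻¹ * (∑ t : Fin T, scoreIncr K p θ e t (x t)) ^ 2 := by
      intro x
      have h7 : (√(T : ℝ) • score p (freq K x) θ) i =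
          inner ℝ e (√(T : ℝ) • score p (freq K x) θ) := by
        simp [e, EuclideanSpace.inner_single_left]
      rw [h7, score_freq, inner_smul_right, inner_score h.period_pos, mul_pow, inv_pow,
        Real.sq_sqrt (Nat.cast_nonneg T)]
    calc _ = (T : ℝ)⁻¹ * ∑ x : Path T, pathMass (gateProb Φ) (fun t => p t θ) T x *
          (∑ t : Fin T, scoreIncr K p θ e t (x t)) ^ 2 := by
          rw [Finset.mul_sum]
          refine Finset.sum_congr rfl fun x _ => ?_
          rw [hxi]
          ring
      _ ≤ (T : ℝ)⁻¹ * ((c⁻¹ * M) ^ 2 * T) := by gcongr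
      _ = _ := by field_simp
  calc _ ≤ ∑ x : Path T, pathMass (gateProb Φ) (fun t => p t θ) T x *
        (1 + ∑ i, (√(T : ℝ) • score p (freq K x) θ) i ^ 2) := by
        refine Finset.sum_le_sum fun x _ => mul_le_mul_of_nonneg_left ?_ (hmn x)
        rw [← EuclideanSpace.real_norm_sq_eq]
        nlinarith [sq_nonneg (‖√(T : ℝ) • score p (freq K x) θ‖ - 1)]
    _ = 1 + ∑ i, ∑ x : Path T, pathMass (gateProb Φ) (fun t => p t θ) T x *
        (√(T : ℝ) • score p (freq K x) θ) i ^ 2 := by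
        simp only [mul_add, mul_one, Finset.sum_add_distrib, sum_pathMass hκ, Finset.mul_sum]
        rw [Finset.sum_comm]
    _ ≤ _ := by
        gcongr with i
        exact hcoord i

/-- The central limit theorem for the score, by the exact evaluation of the expectation of the
compensated exponential. -/
lemma tendsto_sum_exp_score [∀ θ, IsProbabilityMeasure (P θ)]
    (h : IsDEDProcess Θ K D p Φ γ P G Y) (hreg : RegularityAt Θ p γ θ₀) (u w : Param d) :
    Tendsto (fun T : ℕ => ∑ x : Path T,
      (pathMass (gateProb Φ) (fun t => p t (θ₀ + (√(T : ℝ))⁻¹ • u)) T x : ℂ) *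
        Complex.exp ((inner ℝ w (√(T : ℝ) • score p (freq K x) (θ₀ + (√(T : ℝ))⁻¹ • u)) : ℝ) *
          Complex.I)) atTop
      (𝓝 (Complex.exp (-(inner ℝ w (infoOp p θ₀ (γ θ₀) w) : ℝ) / 2))) := by
  have hκ := isGateKernel_gateProb h.measurable_rule
  have hθ₀ : θ₀ ∈ Θ := interior_subset hreg.mem_interior
  obtain ⟨c, hc, hb⟩ := exists_prob_bounds h hreg
  let θs : ℕ → Param d := fun T => θ₀ + (√(T : ℝ))⁻¹ • u
  let m : (T : ℕ) → Path T → ℝ := fun T => pathMass (gateProb Φ) (fun t => p t (θs T)) T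
  let g : ℕ → ℕ → ℝ := fun T r => inner ℝ w (gradient (rate p r) (θs T))
  let φ : ℕ → ℕ → ℂ := fun T r => (p r (θs T) : ℂ) *
        Complex.exp (((√(T : ℝ))⁻¹ * (((p r (θs T))⁻¹ - 1) * g T r) : ℝ) * Complex.I) +
        (1 - p r (θs T) : ℂ) * Complex.exp (((√(T : ℝ))⁻¹ * -g T r : ℝ) * Complex.I)
  let ψ : ℕ → ℕ → ℂ := fun T r => Complex.log (1 + (φ T r - 1))
  let g₀ : ℕ → ℝ := fun r => inner ℝ w (gradient (rate p r) θ₀)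
  let β : Fin K → ℂ := fun r =>
    -(((1 - p r θ₀) / p r θ₀ * g₀ r ^ 2 : ℝ) : ℂ) / 2
  -- The factor `T` turns gate counts into frequencies: the sum of `ψ` over open gates is the gate
  -- frequencies paired with `b`, which has a finite limit.
  let b : ℕ → Fin K → ℂ := fun T r => (T : ℂ) * ψ T r
  have hφ : ∀ r : Fin K, Tendsto (fun T : ℕ => (T : ℂ) * (φ T r - 1)) atTop (𝓝 (β r)) := by
    intro r
    refine tendsto_mul_log_charFun ?_ ?_ (hc.trans_le (hb θ₀ hθ₀ r).1).ne'
    · exact (hasStrictFDerivAt_prob h hreg hreg.mem_interior r).continuousAt.tendsto.comp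
        (tendsto_localParam θ₀ u)
    · exact tendsto_const_nhds.inner (tendsto_gradient_localParam hreg u r)
  have hb_lim : Tendsto b atTop (𝓝 β) :=
    tendsto_pi_nhds.2 fun r => Complex.tendsto_nat_mul_log_one_add_of_tendsto (hφ r)
  have hφ0 : ∀ᶠ T : ℕ in atTop, ∀ r : Fin K, φ T r ≠ 0 := by
    rw [eventually_all]
    intro r
    have h1 : Tendsto (fun T : ℕ => φ T r) atTop (𝓝 1) := by
      have h2 := (tendsto_inv_atTop_nhds_zero_nat (𝕜 := ℂ)).mul (hφ r)
      rw [zero_mul] at h2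
      have h3 := h2.add_const 1
      rw [zero_add] at h3
      refine h3.congr' ?_
      filter_upwards [eventually_gt_atTop 0] with T hT
      have : (T : ℂ) ≠ 0 := by exact_mod_cast hT.ne'
      field_simp
      ring
    exact h1.eventually_ne one_ne_zero
  let W : (Fin K → ℝ) × (Fin K → ℝ) → (Fin K → ℂ) → ℂ := fun v b =>
    Complex.exp (-∑ r, v.2 r • b r)
  let s : (T : ℕ) → Path T → ℝ := fun T x => inner ℝ w (√(T : ℝ) • score p (freq K x) (θs T))
  -- Each open-gate factor is divided by its conditional characteristic function `exp ψ = φ`, so the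
  -- product is a multiplicative martingale with mean exactly one.
  have hone : ∀ᶠ T : ℕ in atTop, ∑ x : Path T, (m T x : ℂ) *
      (Complex.exp (s T x * Complex.I) * W (freq K x) (b T)) = 1 := by
    filter_upwards [hφ0, eventually_localParam_mem hreg u, eventually_gt_atTop 0] with T hφT hT hT0
    let F : ℕ → Bool × Bool → ℂ := fun t a => outcomeMass (p t (θs T)) a *
      Complex.exp (((√(T : ℝ))⁻¹ * scoreIncr K p (θs T) w t a : ℝ) * Complex.I -
        if a.1 then ψ T (t % K) else 0)
    have hF : ∀ t g, F t (g, true) + F t (g, false) = 1 := by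
      intro t gt
      cases gt
      · simp [F, outcomeMass, scoreIncr]
      · have hexp : Complex.exp (ψ T (t % K)) = φ T (t % K) := by
          simp only [ψ, add_sub_cancel]
          exact Complex.exp_log (hφT ⟨t % K, Nat.mod_lt _ h.period_pos⟩)
        have hne : φ T (t % K) ≠ 0 := hφT ⟨t % K, Nat.mod_lt _ h.period_pos⟩
        simp only [F, outcomeMass, scoreIncr, if_true, Complex.exp_sub, hexp,
          Bool.false_eq_true, if_false]
        rw [mul_div_assoc', mul_div_assoc', ← add_div, div_eq_one_iff_eq hne]
        have hpt : p t (θs T) = p (t % K) (θs T) := (h.apply_mod hT t).symm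
        simp only [φ, g, hpt]
        push_cast
        rfl
    rw [← sum_gateMass_mul_prod hκ hF T]
    refine Finset.sum_congr rfl fun x _ => ?_
    have hT0' : (T : ℂ) ≠ 0 := by exact_mod_cast hT0.ne'
    have hψ : ∑ t : Fin T, (if (x t).1 then ψ T (t % K) else 0) =
        ∑ r : Fin K, (freq K x).2 r • b T r := by
      have h1 := sum_phase h.period_pos x (ψ T) (ψ T)
      simp only [ite_self, ← add_smul, add_sub_cancel] at h1
      rw [h1]
      refine Finset.sum_congr rfl fun r _ => ?_
      simp only [freq, b, Pi.smul_apply, smul_eq_mul, Complex.real_smul]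
      push_cast
      field_simp
    have hs : (s T x : ℂ) * Complex.I =
        ∑ t : Fin T, ((√(T : ℝ))⁻¹ * scoreIncr K p (θs T) w t (x t) : ℝ) * Complex.I := by
      simp only [s]
      rw [score_freq, inner_smul_right, inner_score h.period_pos, Finset.mul_sum,
        Complex.ofReal_sum, Finset.sum_mul]
    simp only [W, m, F, pathMass]
    rw [Finset.prod_mul_distrib, ← Complex.exp_sum, Finset.sum_sub_distrib, ← hs, hψ,
      ← Complex.exp_add, ← sub_eq_add_neg]
    push_cast
    ring
  have hWcont : Continuous fun z : ((Fin K → ℝ) × (Fin K → ℝ)) × (Fin K → ℂ) => W z.1 z.2 := by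
    fun_prop
  -- As `exp (i s)` has modulus one, the random compensator can be replaced by its constant limit.
  -- The compensator is bounded because the gate frequencies lie in `[0, 1]` and `b` converges.
  have hsmall : Tendsto (fun T : ℕ => ∑ x : Path T, (m T x : ℂ) *
      (Complex.exp (s T x * Complex.I) * (W (freq K x) (b T) - W (limitFreq p γ θ₀) β)))
      atTop (𝓝 0) := by
    refine tendsto_sum_weight_mul (V := fun T x => freq K x) (v₀ := limitFreq p γ θ₀)
      (g := fun _ _ => 1) (B := 1)
      (C := Real.exp (∑ r, (‖β r‖ + 1)) + ‖W (limitFreq p γ θ₀) β‖) ?_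
      (fun U hU => tendsto_pathProb_freq_local h hreg u hU) (fun _ _ => zero_le_one) ?_ ?_ ?_
    · filter_upwards [eventually_localParam_mem hreg u] with T hT
      exact pathMass_nonneg hκ (h.mem_Icc hT) T
    · refine Eventually.of_forall fun T => ?_
      simp only [mul_one, m]
      exact (sum_pathMass hκ _ T).le
    · have hbound : ∀ᶠ T : ℕ in atTop, ∀ r, ‖b T r‖ ≤ ‖β r‖ + 1 := by
        rw [eventually_all]
        exact fun r => (tendsto_pi_nhds.1 hb_lim r).norm.eventually_le_const (lt_add_one _)
      filter_upwards [hbound] with T hbT x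
      rw [norm_mul, Complex.norm_exp_ofReal_mul_I, one_mul]
      refine (norm_sub_le _ _).trans (add_le_add_left ?_ _)
      refine (Complex.norm_exp_le_exp_norm _).trans (Real.exp_le_exp.2 ?_)
      rw [norm_neg]
      refine (norm_sum_le _ _).trans (Finset.sum_le_sum fun r _ => ?_)
      rw [norm_smul]
      have h1 : ‖(freq K x).2 r‖ ≤ 1 := by
        simp only [freq, Pi.smul_apply, smul_eq_mul]
        rw [Real.norm_of_nonneg (mul_nonneg (by positivity) (gateCount_nonneg x r)),
          inv_mul_eq_div]
        exact div_le_one_of_le₀ (gateCount_le x r) (Nat.cast_nonneg T)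
      calc _ ≤ 1 * ‖b T r‖ := mul_le_mul_of_nonneg_right h1 (norm_nonneg _)
        _ ≤ _ := by rw [one_mul]; exact hbT r
    · intro ε hε
      have h1 : ∀ᶠ z in 𝓝 (limitFreq p γ θ₀) ×ˢ 𝓝 β,
          ‖W z.1 z.2 - W (limitFreq p γ θ₀) β‖ < ε := by
        rw [← nhds_prod_eq]
        have := Metric.tendsto_nhds.1 (hWcont.tendsto (limitFreq p γ θ₀, β)) ε hε
        simpa [dist_eq_norm] using this
      obtain ⟨U, hU, V, hV, hUV⟩ := Filter.mem_prod_iff.1 h1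
      refine ⟨U, hU, ?_⟩
      filter_upwards [hb_lim.eventually_mem hV] with T hT x _ hx
      rw [norm_mul, Complex.norm_exp_ofReal_mul_I, one_mul, mul_one]
      have h2 := hUV (Set.mk_mem_prod hx hT)
      exact (show ‖W (freq K x) (b T) - W (limitFreq p γ θ₀) β‖ < ε from h2).le
  have hlim : Tendsto (fun T : ℕ => (∑ x : Path T, (m T x : ℂ) *
      Complex.exp (s T x * Complex.I)) * W (limitFreq p γ θ₀) β) atTop (𝓝 1) := by
    have h1 := (tendsto_const_nhds (x := (1 : ℂ))).sub hsmall
    rw [sub_zero] at h1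
    refine h1.congr' ?_
    filter_upwards [hone] with T hT
    rw [← hT, ← Finset.sum_sub_distrib, Finset.sum_mul]
    refine Finset.sum_congr rfl fun x _ => ?_
    ring
  have hfin := hlim.mul_const (W (limitFreq p γ θ₀) β)⁻¹
  have hW0 : W (limitFreq p γ θ₀) β ≠ 0 := Complex.exp_ne_zero _
  have hWval : (W (limitFreq p γ θ₀) β)⁻¹ =
      Complex.exp (-(inner ℝ w (infoOp p θ₀ (γ θ₀) w) : ℝ) / 2) := by
    simp only [W, limitFreq, β]
    rw [← Complex.exp_neg, neg_neg, infoOp_apply, inner_sum, Complex.ofReal_sum,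
      ← Finset.sum_neg_distrib, Finset.sum_div]
    congr 1
    refine Finset.sum_congr rfl fun r _ => ?_
    rw [inner_smul_right, real_inner_comm w, Complex.real_smul]
    simp only [g₀]
    push_cast
    ring
  rw [one_mul, hWval] at hfin
  refine hfin.congr fun T => ?_
  rw [← hWval, mul_assoc, mul_inv_cancel₀ hW0, mul_one]

end

/-! ### Consistency, limit law and regularity -/

section

variable {d K D : ℕ} {Ω : Type*} [MeasurableSpace Ω] {Θ : Set (Param d)} {p : ℕ → Param d → ℝ}
  {Φ : (t : ℕ) → Path t × unitInterval → Bool} {γ : Param d → Fin K → ℝ}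
  {P : Param d → Measure Ω} {G Y : ℕ → Ω → Bool} {θ₀ θ : Param d}

lemma infoOp_infoInv (hreg : RegularityAt Θ p γ θ₀) (w : Param d) :
    infoOp p θ₀ (γ θ₀) (infoInv p θ₀ (γ θ₀) w) = w := by
  have h1 : infoRate p θ₀ (γ θ₀) * (infoRate p θ₀ (γ θ₀))⁻¹ = 1 :=
    Matrix.mul_nonsing_inv _ ((Matrix.isUnit_iff_isUnit_det _).1 hreg.info_posDef.isUnit)
  have h2 := congrArg (Matrix.toEuclideanCLM (𝕜 := ℝ)) h1
  rw [map_mul, map_one] at h2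
  exact congrArg (fun L : Param d →L[ℝ] Param d => L w) h2

lemma inner_infoOp_comm (p : ℕ → Param d → ℝ) (θ : Param d) (α : Fin K → ℝ) (v w : Param d) :
    inner ℝ (infoOp p θ α v) w = inner ℝ v (infoOp p θ α w) := by
  rw [infoOp_apply, infoOp_apply, inner_sum, sum_inner]
  refine Finset.sum_congr rfl fun r _ => ?_
  rw [inner_smul_left, inner_smul_right, real_inner_comm v]
  simp only [conj_trivial]
  ring

lemma inner_infoInv_comm (hreg : RegularityAt Θ p γ θ₀) (v w : Param d) :
    inner ℝ (infoInv p θ₀ (γ θ₀) v) w = inner ℝ v (infoInv p θ₀ (γ θ₀) w) := by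
  conv_lhs => rw [← infoOp_infoInv hreg w]
  rw [← inner_infoOp_comm, infoOp_infoInv hreg]

/-- The limiting covariance written as `J I J` with `J` the inverse of the information `I`, the form
produced by the score limit in direction `J t`. -/
lemma charFun_limit (hreg : RegularityAt Θ p γ θ₀) (t : Param d) :
    charFun (multivariateGaussian 0 (infoRate p θ₀ (γ θ₀))⁻¹) t =
      Complex.exp (-(inner ℝ (infoInv p θ₀ (γ θ₀) t)
        (infoOp p θ₀ (γ θ₀) (infoInv p θ₀ (γ θ₀) t)) : ℝ) / 2) := by
  rw [charFun_multivariateGaussian hreg.info_posDef.inv.posSemidef, infoOp_infoInv hreg]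
  have h : inner ℝ (infoInv p θ₀ (γ θ₀) t) t =
      t.ofLp ⬝ᵥ ((infoRate p θ₀ (γ θ₀))⁻¹).mulVec t.ofLp := by
    rw [EuclideanSpace.inner_eq_star_dotProduct, infoInv, Matrix.ofLp_toEuclideanCLM]
    simp
  rw [h]
  congr 1
  simp
  ring

lemma isMaxOn_freq [∀ θ, IsProbabilityMeasure (P θ)]
    (h : IsDEDProcess Θ K D p Φ γ P G Y) (hreg : RegularityAt Θ p γ θ₀) {est : Estimator d}
    (hest : IsMLE Θ P G Y est) {T : ℕ} {x : Path T} {q : ℕ → ℝ}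
    (hx : pathMass (gateProb Φ) q T x ≠ 0) :
    IsMaxOn (countLogLik p (freq K x)) Θ (est T x) := by
  have hscale : ∀ θ, countLogLik p (freq K x) θ =
      (T : ℝ)⁻¹ * countLogLik p (detCount K x, gateCount K x) θ := by
    intro θ
    rw [countLogLik, countLogLik, Finset.mul_sum]
    refine Finset.sum_congr rfl fun r _ => ?_
    simp only [freq, Pi.smul_apply, smul_eq_mul]
    ring
  intro θ hθ
  change countLogLik p _ θ ≤ countLogLik p _ (est T x)
  rw [hscale, hscale]
  exact mul_le_mul_of_nonneg_left (isMaxOn_countLogLik h hreg hest hx hθ) (by positivity)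

theorem isConsistentAt_of_isMLE [∀ θ, IsProbabilityMeasure (P θ)]
    (h : IsDEDProcess Θ K D p Φ γ P G Y) (hreg : RegularityAt Θ p γ θ₀) {est : Estimator d}
    (hest : IsMLE Θ P G Y est) : IsConsistentAt P G Y est θ₀ := by
  have hκ := isGateKernel_gateProb h.measurable_rule
  have hθ₀ : θ₀ ∈ Θ := interior_subset hreg.mem_interior
  rw [IsConsistentAt, tendstoInMeasure_iff_measureReal_dist]
  intro ε hε
  have hU := eventually_maximizer_near h hreg (Metric.ball_mem_nhds θ₀ hε)
  refine squeeze_zero (fun T => measureReal_nonneg) (fun T => ?_) (tendsto_pathProb_freq h hθ₀ hU)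
  rw [show {ω | ε ≤ dist (est T (obs G Y T ω)) θ₀} =
    obs G Y T ⁻¹' {x | ε ≤ dist (est T x) θ₀} from rfl,
    (h.law θ₀ hθ₀).measureReal_preimage_obs h.measurable_rule h.measurable_gate
      h.measurable_outcome]
  refine pathProb_mono (pathMass_nonneg hκ (h.mem_Icc hθ₀) T) fun x hx hx0 hcon => ?_
  exact absurd (Metric.mem_ball.1 (hcon _ (hest T x).1 (isMaxOn_freq h hreg hest hx0)))
    (not_lt.2 hx)

lemma norm_exp_mul_I_sub_le (a b : ℝ) :
    ‖Complex.exp (a * Complex.I) - Complex.exp (b * Complex.I)‖ ≤ |a - b| := by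
  have h1 : Complex.exp (a * Complex.I) - Complex.exp (b * Complex.I) =
      Complex.exp (b * Complex.I) * (Complex.exp (Complex.I * ((a - b : ℝ) : ℂ)) - 1) := by
    rw [mul_sub, ← Complex.exp_add, mul_one]
    congr 2
    push_cast
    ring
  rw [h1, norm_mul, Complex.norm_exp_ofReal_mul_I, one_mul]
  exact Real.norm_exp_I_mul_ofReal_sub_one_le

/-- The characteristic function of the scaled error of a maximum likelihood estimator converges
under every sequence of local alternatives. -/
theorem tendsto_charFun_of_isMLE [∀ θ, IsProbabilityMeasure (P θ)]
    (h : IsDEDProcess Θ K D p Φ γ P G Y) (hreg : RegularityAt Θ p γ θ₀) {est : Estimator d}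
    (hest : IsMLE Θ P G Y est) (u t : Param d) :
    Tendsto (fun T : ℕ => ∑ x : Path T,
      (pathMass (gateProb Φ) (fun t => p t (θ₀ + (√(T : ℝ))⁻¹ • u)) T x : ℂ) *
        Complex.exp ((inner ℝ (√(T : ℝ) • (est T x - (θ₀ + (√(T : ℝ))⁻¹ • u))) t : ℝ) *
          Complex.I)) atTop
      (𝓝 (charFun (multivariateGaussian 0 (infoRate p θ₀ (γ θ₀))⁻¹) t)) := by
  have hκ := isGateKernel_gateProb h.measurable_rule
  let θs : ℕ → Param d := fun T => θ₀ + (√(T : ℝ))⁻¹ • u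
  let m : (T : ℕ) → Path T → ℝ := fun T => pathMass (gateProb Φ) (fun t => p t (θs T)) T
  set J := infoInv p θ₀ (γ θ₀)
  have hclt := tendsto_sum_exp_score h hreg u (J t)
  rw [← charFun_limit hreg t] at hclt
  obtain ⟨B, hB⟩ := exists_sum_norm_score_le h hreg u
  let ξ : (T : ℕ) → Path T → ℝ := fun T x => inner ℝ (√(T : ℝ) • (est T x - θs T)) t
  let η : (T : ℕ) → Path T → ℝ := fun T x =>
    inner ℝ (J t) (√(T : ℝ) • score p (freq K x) (θs T))
  -- Near the limiting frequencies the expansion bounds the phase difference by `ε` times the norm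
  -- of the normalized score, which is bounded in `L¹`. Elsewhere the difference is at most two, on
  -- a set of vanishing probability.
  have hdiff : Tendsto (fun T : ℕ => ∑ x : Path T, (m T x : ℂ) *
      (Complex.exp (ξ T x * Complex.I) - Complex.exp (η T x * Complex.I))) atTop (𝓝 0) := by
    refine tendsto_sum_weight_mul (V := fun T x => freq K x) (v₀ := limitFreq p γ θ₀)
      (g := fun T x => ‖√(T : ℝ) • score p (freq K x) (θs T)‖) (B := B) (C := 2) ?_
      (fun U hU => tendsto_pathProb_freq_local h hreg u hU) (fun _ _ => norm_nonneg _) hB ?_ ?_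
    · filter_upwards [eventually_localParam_mem hreg u] with T hT
      exact pathMass_nonneg hκ (h.mem_Icc hT) T
    · refine Eventually.of_forall fun T x => (norm_sub_le _ _).trans ?_
      rw [Complex.norm_exp_ofReal_mul_I, Complex.norm_exp_ofReal_mul_I]
      norm_num
    · intro ε hε
      have hJ : 0 < ‖t‖ * ‖J‖ + 1 := by positivity
      have h1 := eventually_maximizer_expansion h hreg (div_pos hε hJ)
      obtain ⟨U, hU, V, hV, hUV⟩ := Filter.mem_prod_iff.1 h1
      refine ⟨U, hU, ?_⟩
      filter_upwards [(tendsto_localParam θ₀ u).eventually_mem hV] with T hT x hx0 hx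
      have h2 : ‖est T x - θs T - J (score p (freq K x) (θs T))‖ ≤
          ε / (‖t‖ * ‖J‖ + 1) * ‖J (score p (freq K x) (θs T))‖ :=
        hUV (Set.mk_mem_prod hx hT) _ (hest T x).1 (isMaxOn_freq h hreg hest hx0)
      refine (norm_exp_mul_I_sub_le _ _).trans ?_
      have h3 : ξ T x - η T x =
          inner ℝ (√(T : ℝ) • (est T x - θs T - J (score p (freq K x) (θs T)))) t := by
        simp only [ξ, η]
        rw [inner_infoInv_comm hreg, real_inner_comm, ← inner_sub_right, real_inner_comm,
          smul_sub _ (est T x - θs T), map_smul]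
      rw [h3]
      refine (abs_real_inner_le_norm _ _).trans ?_
      rw [norm_smul, norm_smul]
      have h4 := J.le_opNorm (score p (freq K x) (θs T))
      set S := ‖score p (freq K x) (θs T)‖
      have hS : 0 ≤ S := norm_nonneg _
      calc _ ≤ ‖√(T : ℝ)‖ * (ε / (‖t‖ * ‖J‖ + 1) * (‖J‖ * S)) * ‖t‖ := by
            gcongr
            exact h2.trans (by gcongr)
        _ = (ε / (‖t‖ * ‖J‖ + 1) * (‖t‖ * ‖J‖)) * (‖√(T : ℝ)‖ * S) := by ring
        _ ≤ (ε / (‖t‖ * ‖J‖ + 1) * (‖t‖ * ‖J‖ + 1)) * (‖√(T : ℝ)‖ * S) := by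
            gcongr
            linarith
        _ = ε * (‖√(T : ℝ)‖ * S) := by field_simp
  have hsum := hdiff.add hclt
  rw [zero_add] at hsum
  refine hsum.congr fun T => ?_
  rw [← Finset.sum_add_distrib]
  refine Finset.sum_congr rfl fun x _ => ?_
  simp only [m, ξ, η, θs]
  ring

theorem isRegularAt_of_isMLE [∀ θ, IsProbabilityMeasure (P θ)]
    (h : IsDEDProcess Θ K D p Φ γ P G Y) (hreg : RegularityAt Θ p γ θ₀) {est : Estimator d}
    (hest : IsMLE Θ P G Y est) :
    IsRegularAt P G Y est θ₀ (multivariateGaussian 0 (infoRate p θ₀ (γ θ₀))⁻¹) := by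
  intro u
  have hm : ∀ T : ℕ, Measurable fun ω =>
      √(T : ℝ) • (est T (obs G Y T ω) - θ₀ - (√(T : ℝ))⁻¹ • u) := fun T =>
    (Measurable.of_discrete (f := fun x => √(T : ℝ) • (est T x - θ₀ - (√(T : ℝ))⁻¹ • u))).comp
      (measurable_obs h.measurable_gate h.measurable_outcome T)
  refine ⟨fun T => (hm T).aemeasurable, aemeasurable_id, ?_⟩
  refine ProbabilityMeasure.tendsto_iff_tendsto_charFun.2 fun t => ?_
  simp only [ProbabilityMeasure.coe_mk, Measure.map_id]
  refine (tendsto_charFun_of_isMLE h hreg hest u t).congr' ?_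
  -- The law is described only for parameters in `Θ`, which contains the local parameter for large
  -- `T` because `θ₀` is interior.
  filter_upwards [eventually_localParam_mem hreg u] with T hT
  rw [charFun_apply, integral_map (hm T).aemeasurable (by fun_prop),
    (h.law _ hT).integral_comp_obs h.measurable_rule h.measurable_gate h.measurable_outcome
      (fun x => Complex.exp ((inner ℝ (√(T : ℝ) • (est T x - θ₀ - (√(T : ℝ))⁻¹ • u)) t : ℝ) *
        Complex.I))]
  refine Finset.sum_congr rfl fun x _ => ?_
  rw [Complex.real_smul, sub_sub]

theorem hasErrorLimit_of_isMLE [∀ θ, IsProbabilityMeasure (P θ)]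
    (h : IsDEDProcess Θ K D p Φ γ P G Y) (hreg : RegularityAt Θ p γ θ₀) {est : Estimator d}
    (hest : IsMLE Θ P G Y est) :
    HasErrorLimit P G Y est θ₀ (multivariateGaussian 0 (infoRate p θ₀ (γ θ₀))⁻¹) := by
  have h0 := isRegularAt_of_isMLE h hreg hest 0
  unfold HasErrorLimit
  simpa only [smul_zero, sub_zero, add_zero] using h0

end

end DED

theorem theorem3 {d K D : ℕ} {Ω : Type*} [MeasurableSpace Ω]
    (Θ : Set (DED.Param d)) (p : ℕ → DED.Param d → ℝ)
    (Φ : (t : ℕ) → DED.Path t × unitInterval → Bool)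
    (γ : DED.Param d → Fin K → ℝ)
    (P : DED.Param d → Measure Ω) [∀ θ, IsProbabilityMeasure (P θ)]
    (G Y : ℕ → Ω → Bool)
    (hDED : DED.IsDEDProcess Θ K D p Φ γ P G Y)
    (θ₀ : DED.Param d) (hreg : DED.RegularityAt Θ p γ θ₀)
    (est : DED.Estimator d) (hest : DED.IsMLE Θ P G Y est) :
    DED.IsConsistentAt P G Y est θ₀ ∧
    DED.HasErrorLimit P G Y est θ₀
      (multivariateGaussian 0 (DED.infoRate p θ₀ (γ θ₀))⁻¹) ∧
    DED.IsRegularAt P G Y est θ₀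
      (multivariateGaussian 0 (DED.infoRate p θ₀ (γ θ₀))⁻¹) ∧
    DED.IsEfficientAt p γ P G Y est θ₀ :=
  have hlim := DED.hasErrorLimit_of_isMLE hDED hreg hest
  ⟨DED.isConsistentAt_of_isMLE hDED hreg hest, hlim,
    DED.isRegularAt_of_isMLE hDED hreg hest, hlim⟩
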